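/- Let $p$ be an odd prime, let $q\in\mathbf{Z}_p^\times$ be a topological generator of $\mathbf{Z}_p^\times$, let $N\ge 1$, and let $\sigma\in S_N$ be a permutation with $g$ cycles (fixed points included); choose representatives $i_1,\dots,i_g\in\{1,\dots,N\}$ of the cycles and let $k_j$ be the length of the cycle of $i_j$. Write $x\sim y$ for "$x$ is conjugate to $y$". Let $F$ be the pro-$p$ group generated by $x_1,\dots,x_N$ subject to the single relation $x_1\cdots x_N=1$. Let $P_N$ be the group of continuous automorphisms $\alpha$ of $F$ with $\alpha(x_i)\sim x_i$ for all $i$ (a compact group in the compact-open topology), and let $B_N(q,\sigma)$ be the set of continuous automorphisms $\alpha$ of $F$ with $\alpha(x_i)\sim x_{\sigma(i)}^{q}$ for all $i$. Then $B_N(q,\sigma)$ is non-empty, hence a coset of $P_N$ and endowed with its normalized Haar measure (the translate of the Haar probability measure of $P_N$ by any element of $B_N(q,\sigma)$). Let $\mathbf{G}(q,\sigma)$ be the random pro-$p$ group obtained as the quotient of $F$ by the relations $\alpha(x_i)=x_i$, $1\le i\le N$ (that is, by the closed normal subgroup generated by the elements $\alpha(x_i)x_i^{-1}$), where $\alpha$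 is a random element of $B_N(q,\sigma)$ for this measure. Put $W(q,\sigma)=\bigoplus_{j=1}^g \mathbf{Z}_p/(q^{k_j}-1)\mathbf{Z}_p$. Let $\Gamma$ be a finite $p$-group with abelianization $\pi:\Gamma\to\Gamma^{ab}$. Assume that $\Gamma$ is balanced, i.e. $\dim H^1(\Gamma,\mathbf{F}_p)=\dim H^2(\Gamma,\mathbf{F}_p)$, and that $\Gamma^{ab}\cong W(q,\sigma)$. For a $g$-tuple $\mathbf{c}=(c_1,\dots,c_g)$ of conjugacy classes of $\Gamma$ such that $c_1,\dots,c_g$ generate $\Gamma$ and $c_j^{q^{k_j}}=c_j$ for all $j$, let $\mathrm{Epi}(F,(\Gamma,\mathbf{c}))$ be the set of continuous surjective homomorphisms $F\to\Gamma$ sending $x_{\sigma^m(i_j)}$ into the class $c_j^{q^{-m}}$ for all $j$ and all $m\ge 0$. Assume (transitivity heuristic) that for every such $\mathbf{c}$ the group $P_N$, acting by composition, acts transitively on $\mathrm{Epi}(F,(\Gamma,\mathbf{c}))$, i.e. that this set is a single (non-empty) $P_N$-orbit. Let $Z=(Z_1,\dots,Z_g)$, where $Z_j\subset\mathbf{Z}_p^\times$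 is the closed subgroup generated by $q^{k_j}$, let $W_j=\mathbf{Z}_p/(z-1: z\in Z_j)$, and $W(Z)=\bigoplus_j W_j$ (so $W(Z)=W(q,\sigma)$). Let $A_Z(\Gamma)$ be the number of pairs $((c_1,\dots,c_g),\iota)$, where $c_1,\dots,c_g$ are conjugacy classes of $\Gamma$ and $\iota\in\Gamma$ satisfies $\iota^2=1$ (so $\iota=1$, as $p$ is odd), such that - $c_i^{z}=c_i$ for all $z\in Z_i$ and all $i$; - $\pi(c_1),\dots,\pi(c_g)$ generate $\Gamma^{ab}$; - the map $W(Z)\to\Gamma^{ab}$, $(w_1,\dots,w_g)\mapsto\sum_i w_i\,\pi(c_i)$, is a (well-defined) isomorphism. Then the event that $\mathbf{G}(q,\sigma)$ is isomorphic to $\Gamma$ is measurable, and $$\mathbf{P}\bigl(\mathbf{G}(q,\sigma)\cong\Gamma\bigr)=\frac{A_Z(\Gamma)}{|\mathrm{Aut}(\Gamma)|}.$$ -/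

import Mathlib

open MeasureTheory Filter Topology

noncomputable section

namespace RandomProP

/-! ### Pro-`p` completions -/

section Completion

variable (p : ℕ) (D : Type*) [Group D]

/-- The normal subgroups of `p`-power index of a group `D`. -/
abbrev PIndex : Type _ := {K : Subgroup D // K.Normal ∧ ∃ n : ℕ, K.index = p ^ n}

variable {p D}

/-- The finite `p`-group `D ⧸ K`, with the discrete topology. -/
def PQuot (K : PIndex p D) : Type _ := D ⧸ K.1

instance (K : PIndex p D) : Group (PQuot K) :=
  letI := K.2.1
  inferInstanceAs (Group (D ⧸ K.1))

instance (K : PIndex p D) : TopologicalSpace (PQuot K) := ⊥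

instance (K : PIndex p D) : DiscreteTopology (PQuot K) := ⟨rfl⟩

instance [Fact p.Prime] (K : PIndex p D) : Finite (PQuot K) := by
  obtain ⟨n, hn⟩ := K.2.2
  have : K.1.FiniteIndex := ⟨by
    rw [hn]
    exact pow_ne_zero _ (Fact.out : p.Prime).ne_zero⟩
  exact inferInstanceAs (Finite (D ⧸ K.1))

/-- The projection `D → D ⧸ K`. -/
def PQuot.proj (K : PIndex p D) : D →* PQuot K :=
  letI := K.2.1
  QuotientGroup.mk' K.1

variable (p D)

/-- The pro-`p` completion of `D`: the closure of the image of `D` in the product of all its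
quotients `D ⧸ K` of `p`-power order (this is the inverse limit of these quotients). -/
def ProPCompletion : Subgroup (∀ K : PIndex p D, PQuot K) :=
  (MonoidHom.pi fun K : PIndex p D => PQuot.proj K).range.topologicalClosure

instance [Fact p.Prime] : CompactSpace (ProPCompletion p D) :=
  isCompact_iff_compactSpace.1 (Subgroup.isClosed_topologicalClosure _).isCompact

/-- The canonical homomorphism from `D` to its pro-`p` completion. -/
def toCompletion : D →* ProPCompletion p D :=
  (MonoidHom.pi fun K : PIndex p D => PQuot.proj K).codRestrict _
    fun d => Subgroup.le_topologicalClosure _ ⟨d, rfl⟩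

end Completion

/-- `ℤ_p`-powers in a topological group: if `z₀, z₁, …` are the natural numbers `zₙ < p ^ n` with
`zₙ ≡ z` modulo `p ^ n`, then `x ^ z` is the limit of `x ^ zₙ`. The limit exists in every
pro-`p` group; in particular in a finite `p`-group with the discrete topology. -/
def padicPow {p : ℕ} [Fact p.Prime] {G : Type*} [Group G] [TopologicalSpace G]
    (x : G) (z : ℤ_[p]) : G :=
  limUnder atTop fun n : ℕ => x ^ z.appr n

/-! ### Automorphism groups of topological groups -/

section Aut

variable {G : Type*} [Group G] [TopologicalSpace G]

/-- The group of continuous automorphisms, with composition: `(α * β) x = α (β x)`. -/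
instance autGroup : Group (G ≃ₜ* G) where
  mul α β := β.trans α
  one := ContinuousMulEquiv.refl G
  inv α := α.symm
  mul_assoc _ _ _ := rfl
  one_mul _ := rfl
  mul_one _ := rfl
  inv_mul_cancel α := ContinuousMulEquiv.ext α.symm_apply_apply

/-- An automorphism together with its inverse, as continuous endomorphisms. -/
def autToHomProd (α : G ≃ₜ* G) : (G →ₜ* G) × (G →ₜ* G) :=
  ((α : G →ₜ* G), ((α⁻¹ : G ≃ₜ* G) : G →ₜ* G))

/-- The compact-open topology on the automorphism group (for `α` and `α⁻¹`). -/
instance autTopology : TopologicalSpace (G ≃ₜ* G) :=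
  TopologicalSpace.induced autToHomProd inferInstance

instance autMeasurableSpace : MeasurableSpace (G ≃ₜ* G) := borel _

instance autBorelSpace : BorelSpace (G ≃ₜ* G) := ⟨rfl⟩

lemma aut_mul_apply (α β : G ≃ₜ* G) (x : G) : (α * β) x = α (β x) := rfl

lemma autToHomProd_inducing : IsInducing (autToHomProd (G := G)) := ⟨rfl⟩

instance autTopologicalGroup [LocallyCompactSpace G] : IsTopologicalGroup (G ≃ₜ* G) where
  continuous_mul := by
    have h := (autToHomProd_inducing (G := G)).continuous
    refine autToHomProd_inducing.continuous_iff.2 (Continuous.prodMk ?_ ?_)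
    · exact ContinuousMonoidHom.continuous_comp.comp
        ((h.fst.comp continuous_snd).prodMk (h.fst.comp continuous_fst))
    · exact ContinuousMonoidHom.continuous_comp.comp
        ((h.snd.comp continuous_fst).prodMk (h.snd.comp continuous_snd))
  continuous_inv := by
    have h := (autToHomProd_inducing (G := G)).continuous
    exact autToHomProd_inducing.continuous_iff.2 (h.snd.prodMk h.fst)

lemma aut_continuous_apply (x : G) : Continuous fun α : G ≃ₜ* G => α x :=
  (continuous_eval_const (F := G →ₜ* G) x).comp
    (autToHomProd_inducing (G := G)).continuous.fst

/-- If the continuous endomorphisms form a compact space, so do the automorphisms. -/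
lemma aut_compactSpace [T2Space G] [LocallyCompactSpace G] [CompactSpace (G →ₜ* G)] :
    CompactSpace (G ≃ₜ* G) := by
  have hr : Set.range (autToHomProd (G := G)) =
      {f | f.2.comp f.1 = ContinuousMonoidHom.id G ∧ f.1.comp f.2 = ContinuousMonoidHom.id G} := by
    ext f
    constructor
    · rintro ⟨α, rfl⟩
      exact ⟨ContinuousMonoidHom.ext fun x => α.symm_apply_apply x,
        ContinuousMonoidHom.ext fun x => α.apply_symm_apply x⟩
    · rintro ⟨h1, h2⟩
      refine ⟨⟨⟨⟨f.1, f.2, fun x => DFunLike.congr_fun h1 x, fun x => DFunLike.congr_fun h2 x⟩,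
        map_mul f.1⟩, f.1.continuous_toFun, f.2.continuous_toFun⟩, rfl⟩
  have hc : IsClosed (Set.range (autToHomProd (G := G))) := by
    rw [hr]
    exact (isClosed_eq ContinuousMonoidHom.continuous_comp continuous_const).inter
      (isClosed_eq (ContinuousMonoidHom.continuous_comp.comp continuous_swap) continuous_const)
  refine ⟨autToHomProd_inducing.isCompact_iff.2 ?_⟩
  rw [Set.image_univ]
  exact hc.isCompact

end Aut

section EndCompact

lemma finite_monoidHom (D Q : Type*) [Group D] [Group.FG D] [Group Q] [Finite Q] :
    Finite (D →* Q) := by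
  obtain ⟨S, hS⟩ := Group.fg_def.1 (inferInstance : Group.FG D)
  refine Finite.of_injective (fun (f : D →* Q) (s : S) => f s) fun f g h => ?_
  exact MonoidHom.eq_of_eqOn_dense hS fun s hs => congrFun h ⟨s, hs⟩

variable {p : ℕ} {D : Type*} [Group D]

lemma toCompletion_denseRange : DenseRange (toCompletion p D) := by
  rw [denseRange_iff_closure_range, Set.eq_univ_iff_forall]
  intro f
  rw [closure_subtype]
  have h := f.2
  refine closure_mono ?_ h
  rintro _ ⟨d, rfl⟩
  exact ⟨toCompletion p D d, ⟨d, rfl⟩, rfl⟩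

lemma isPGroup_pQuot (K : PIndex p D) : IsPGroup p (PQuot K) := by
  obtain ⟨n, hn⟩ := K.2.2
  exact IsPGroup.of_card (n := n) hn

variable [Fact p.Prime]

/-- The kernel of a homomorphism to a finite `p`-group, as an index. -/
def kerIndex {Q : Type*} [Group Q] [Finite Q] (hQ : IsPGroup p Q) (ψ : D →* Q) : PIndex p D :=
  ⟨ψ.ker, inferInstance, by
    obtain ⟨n, hn⟩ := IsPGroup.iff_card.1 (hQ.to_subgroup ψ.range)
    exact ⟨n, by rw [Subgroup.index_ker, hn]⟩⟩

/-- The continuous endomorphisms of the pro-`p` completion of a finitely generated group are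
equicontinuous at the identity. -/
lemma end_equicontinuous_aux [Group.FG D] (K : PIndex p D) :
    ∃ U ∈ 𝓝 (1 : ProPCompletion p D), ∀ φ : ProPCompletion p D →ₜ* ProPCompletion p D,
      ∀ x ∈ U, (φ x).1 K = 1 := by
  have hfin := finite_monoidHom D (PQuot K)
  refine ⟨⋂ ψ : D →* PQuot K, {x | x.1 (kerIndex (isPGroup_pQuot K) ψ) = 1}, ?_, ?_⟩
  · refine Filter.iInter_mem.2 fun ψ => ?_
    refine IsOpen.mem_nhds ?_ rfl
    exact (isOpen_discrete {1}).preimage ((continuous_apply _).comp continuous_subtype_val)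
  · intro φ x hx
    let ψ : D →* PQuot K :=
      ((Pi.evalMonoidHom _ K).comp (ProPCompletion p D).subtype).comp
        ((φ : ProPCompletion p D →* ProPCompletion p D).comp (toCompletion p D))
    let L := kerIndex (isPGroup_pQuot K) ψ
    let χ : PQuot L → PQuot K := QuotientGroup.lift ψ.ker ψ fun _ h => h
    have key : (fun y : ProPCompletion p D => (φ y).1 K) = fun y => χ (y.1 L) := by
      refine toCompletion_denseRange.equalizer ?_ ?_ ?_
      · exact (continuous_apply _).comp (continuous_subtype_val.comp φ.continuous_toFun)
      · exact continuous_of_discreteTopology.comp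
          ((continuous_apply _).comp continuous_subtype_val)
      · rfl
    have h1 : x.1 L = 1 := Set.mem_iInter.1 hx ψ
    have h2 := congrFun key x
    simp only [h1] at h2
    rw [h2]
    exact map_one (QuotientGroup.lift ψ.ker ψ fun _ h => h)

lemma end_equicontinuous [Group.FG D] (V : Set (ProPCompletion p D)) (hV : V ∈ 𝓝 1) :
    ∃ U ∈ 𝓝 (1 : ProPCompletion p D), ∀ φ : ProPCompletion p D →ₜ* ProPCompletion p D,
      ∀ x ∈ U, φ x ∈ V := by
  rw [nhds_subtype_eq_comap, mem_comap] at hV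
  obtain ⟨T, hT, hTV⟩ := hV
  rw [nhds_pi, Filter.mem_pi] at hT
  obtain ⟨J, hJ, t, ht, htT⟩ := hT
  choose U hU hUφ using fun K : PIndex p D => end_equicontinuous_aux K
  refine ⟨⋂ K ∈ J, U K, (Filter.biInter_mem hJ).2 fun K _ => hU K, fun φ x hx => hTV (htT ?_)⟩
  intro K hK
  rw [hUφ K φ x (Set.mem_iInter₂.1 hx K hK)]
  exact mem_of_mem_nhds (ht K)

instance end_compactSpace [Group.FG D] :
    CompactSpace (ProPCompletion p D →ₜ* ProPCompletion p D) := by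
  let _ : UniformSpace (ProPCompletion p D) := IsTopologicalGroup.rightUniformSpace _
  let S : Set (ProPCompletion p D → ProPCompletion p D) :=
    Set.range fun φ : ProPCompletion p D →ₜ* ProPCompletion p D => ⇑φ
  have hS : Equicontinuous ((↑) : S → ProPCompletion p D → ProPCompletion p D) := by
    intro x₀ W hW
    rw [uniformity_eq_comap_mul_inv_nhds_one, mem_comap] at hW
    obtain ⟨V, hV, hVW⟩ := hW
    obtain ⟨U, hU, hUφ⟩ := end_equicontinuous V hV
    have hU' : ∀ᶠ x in 𝓝 x₀, x * x₀⁻¹ ∈ U := by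
      have : Tendsto (fun x => x * x₀⁻¹) (𝓝 x₀) (𝓝 1) := by
        have h : Continuous fun x : ProPCompletion p D => x * x₀⁻¹ := by fun_prop
        simpa using h.tendsto x₀
      exact this hU
    filter_upwards [hU'] with x hx
    rintro ⟨_, φ, rfl⟩
    refine hVW ?_
    simpa using hUφ φ _ hx
  have hSc : IsClosed S := by
    refine isClosed_of_closure_subset fun f hf => ?_
    have hf1 : Continuous f :=
      (Equicontinuous.closure' (u := id) hS continuous_id).continuous ⟨f, hf⟩
    have hf2 := closure_minimal ?_ (MonoidHom.isClosed_range_coe (ProPCompletion p D)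
        (ProPCompletion p D)) hf
    swap
    · change S ⊆ _
      rintro _ ⟨φ, rfl⟩
      exact ⟨(φ : ProPCompletion p D →* ProPCompletion p D), rfl⟩
    obtain ⟨ψ, rfl⟩ := hf2
    exact ⟨⟨ψ, hf1⟩, rfl⟩
  refine ⟨(ContinuousMonoidHom.isInducing_toContinuousMap _ _).isCompact_iff.2 ?_⟩
  refine ArzelaAscoli.isCompact_of_equicontinuous _ ?_ ?_
  · convert hSc.isCompact
    ext f
    simp [S]
  · intro x₀ W hW
    filter_upwards [hS x₀ W hW] with x hx
    rintro ⟨_, φ, -, rfl⟩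
    exact hx ⟨φ, φ, rfl⟩

end EndCompact

/-! ### The group `F` and the pro-`p` braid group -/

/-- The discrete group `⟨x₁, …, x_N | x₁ ⋯ x_N = 1⟩`. -/
abbrev SphereGroup (N : ℕ) : Type :=
  PresentedGroup {(List.ofFn fun i : Fin N => FreeGroup.of i).prod}

instance sphereGroup_fg (N : ℕ) : Group.FG (SphereGroup N) :=
  Group.fg_of_surjective (PresentedGroup.mk_surjective _)

/-- The pro-`p` group `F` generated by `x₁, …, x_N` subject to the single relation
`x₁ ⋯ x_N = 1`. -/
abbrev F (p N : ℕ) : Type := ProPCompletion p (SphereGroup N)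

/-- The generator `x_i` of `F`. -/
def gen (p : ℕ) {N : ℕ} (i : Fin N) : F p N := toCompletion p _ (PresentedGroup.of i)

variable {p : ℕ} [Fact p.Prime]

/-- The pure pro-`p` braid group `P_N`: continuous automorphisms `α` of `F` with `α(x_i) ∼ x_i`. -/
def pureBraid (p N : ℕ) : Subgroup (F p N ≃ₜ* F p N) where
  carrier := {α | ∀ i, IsConj (α (gen p i)) (gen p i)}
  one_mem' _ := IsConj.refl _
  mul_mem' {α β} hα hβ i := by
    have h := MonoidHom.map_isConj (α : F p N →* F p N) (hβ i)
    exact h.trans (hα i)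
  inv_mem' {α} hα i := by
    have h := (MonoidHom.map_isConj ((α⁻¹ : F p N ≃ₜ* F p N) : F p N →* F p N) (hα i)).symm
    have h2 : α⁻¹ (α (gen p i)) = gen p i := α.symm_apply_apply _
    change IsConj (α⁻¹ (gen p i)) (α⁻¹ (α (gen p i))) at h
    rwa [h2] at h

/-- The set `B_N(q, σ)` of continuous automorphisms `α` of `F` with `α(x_i) ∼ x_{σ(i)}^q`. -/
def braidCoset {N : ℕ} (q : ℤ_[p]ˣ) (σ : Equiv.Perm (Fin N)) : Set (F p N ≃ₜ* F p N) :=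
  {α | ∀ i, IsConj (α (gen p i)) (padicPow (gen p (σ i)) (q : ℤ_[p]))}

lemma isClosed_conj {G : Type*} [Group G] [TopologicalSpace G] [IsTopologicalGroup G]
    [CompactSpace G] [T2Space G] (x : G) : IsClosed {y | IsConj y x} := by
  have : {y | IsConj y x} = Set.range fun g : G => g * x * g⁻¹ := by
    ext y
    rw [Set.mem_ofPred_eq, isConj_comm, isConj_iff]
    rfl
  rw [this]
  exact (isCompact_range (by fun_prop)).isClosed

instance pureBraid_compactSpace (N : ℕ) : CompactSpace (pureBraid p N) := by
  have := aut_compactSpace (G := F p N)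
  refine isCompact_iff_compactSpace.1 (IsClosed.isCompact ?_)
  have h : (pureBraid p N : Set (F p N ≃ₜ* F p N)) =
      ⋂ i, (fun α => α (gen p i)) ⁻¹' {y | IsConj y (gen p i)} := by
    ext α
    simp only [Set.mem_iInter]
    rfl
  rw [h]
  exact isClosed_iInter fun i => (isClosed_conj _).preimage (aut_continuous_apply _)

/-- The normalized Haar measure on the compact group `P_N`. -/
def pureBraidHaar (p : ℕ) [Fact p.Prime] (N : ℕ) : Measure (pureBraid p N) :=
  Measure.haarMeasure ⊤

instance pureBraidHaar_isProbabilityMeasure (N : ℕ) :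
    IsProbabilityMeasure (pureBraidHaar p N) :=
  ⟨by simpa [pureBraidHaar] using Measure.haarMeasure_self (G := pureBraid p N) (K₀ := ⊤)⟩

/-- The Haar measure on the coset `α₀ P_N`: the distribution of `α₀ π` with `π` Haar-distributed
on `P_N`. For `α₀ ∈ B_N(q, σ)` this is the Haar measure on `B_N(q, σ)`. -/
def cosetHaar {N : ℕ} (α₀ : F p N ≃ₜ* F p N) : Measure (F p N ≃ₜ* F p N) :=
  (pureBraidHaar p N).map fun π : pureBraid p N => α₀ * (π : F p N ≃ₜ* F p N)

instance cosetHaar_isProbabilityMeasure {N : ℕ} (α₀ : F p N ≃ₜ* F p N) :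
    IsProbabilityMeasure (cosetHaar α₀) :=
  Measure.isProbabilityMeasure_map
    (continuous_const.mul continuous_subtype_val).measurable.aemeasurable

/-- The closed normal subgroup of `F` generated by the elements `α(x_i) x_i⁻¹`. -/
def relSubgroup {N : ℕ} (α : F p N ≃ₜ* F p N) : Subgroup (F p N) :=
  (Subgroup.normalClosure (Set.range fun i => α (gen p i) * (gen p i)⁻¹)).topologicalClosure

instance relSubgroup_normal {N : ℕ} (α : F p N ≃ₜ* F p N) : (relSubgroup α).Normal :=
  Subgroup.is_normal_topologicalClosure _

/-- The quotient of `F` by the relations `α(x_i) = x_i`. For `α` Haar-distributed on `B_N(q, σ)`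
this is the random pro-`p` group `𝐆(q, σ)`. -/
abbrev BraidGroupQuot {N : ℕ} (α : F p N ≃ₜ* F p N) : Type := F p N ⧸ relSubgroup α

/-! ### Types, balanced groups and the number `A_Z(Γ)` -/

/-- A finite `p`-group is balanced if its generator rank `dim H¹(Γ, 𝔽_p)` equals its relator rank
`dim H²(Γ, 𝔽_p)`. -/
def IsBalanced (p : ℕ) [Fact p.Prime] (Γ : Type) [Group Γ] : Prop :=
  Module.finrank (ZMod p) (groupCohomology (Rep.trivial (ZMod p) Γ (ZMod p)) 1) =
    Module.finrank (ZMod p) (groupCohomology (Rep.trivial (ZMod p) Γ (ZMod p)) 2)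

/-- `r` is a system of representatives of the cycles (including fixed points) of `σ`. -/
def IsCycleReps {N g : ℕ} (σ : Equiv.Perm (Fin N)) (r : Fin g → Fin N) : Prop :=
  ∀ i, ∃! j, σ.SameCycle (r j) i

/-- The length of the cycle of `σ` through `i` (which is `1` if `i` is a fixed point). -/
def cycleLen {N : ℕ} (σ : Equiv.Perm (Fin N)) (i : Fin N) : ℕ := Function.minimalPeriod σ i

/-- The group `W(q, σ) = ⨁ ℤ_p / (q ^ k_j - 1)`, where `k_j` is the length of the cycle of `r j`. -/
abbrev WBraid {N g : ℕ} (q : ℤ_[p]ˣ) (σ : Equiv.Perm (Fin N)) (r : Fin g → Fin N) : Type :=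
  ∀ j : Fin g, ℤ_[p] ⧸ Ideal.span {(q : ℤ_[p]) ^ cycleLen σ (r j) - 1}

/-- The type attached to `(q, σ)`: `Z_j` is the closed subgroup of `ℤ_p^×` generated by
`q ^ k_j`. -/
def braidType {N g : ℕ} (q : ℤ_[p]ˣ) (σ : Equiv.Perm (Fin N)) (r : Fin g → Fin N) :
    Fin g → Subgroup ℤ_[p]ˣ :=
  fun j => (Subgroup.zpowers (q ^ cycleLen σ (r j))).topologicalClosure

/-- The group `W(Z) = ⨁ W_i`, where `W_i` is `ℤ_p` modulo the ideal generated by all `z - 1`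
with `z ∈ Z_i` (so `W_i = ℤ_p / (ℓ - 1)` if `Z_i` is the closure of `ℓ^ℤ`). -/
abbrev WType {g : ℕ} (Z : Fin g → Subgroup ℤ_[p]ˣ) : Type :=
  ∀ i : Fin g, ℤ_[p] ⧸ Ideal.span {x : ℤ_[p] | ∃ z ∈ Z i, x = (z : ℤ_[p]) - 1}

/-- The event that the random group `𝐆(q, σ)` is isomorphic to `Γ`. -/
def isoEvent {N : ℕ} (q : ℤ_[p]ˣ) (σ : Equiv.Perm (Fin N)) (Γ : Type) [Group Γ] :
    Set (F p N ≃ₜ* F p N) :=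
  {α ∈ braidCoset q σ | Nonempty (BraidGroupQuot α ≃* Γ)}

section Gamma

variable {Γ : Type} [Group Γ] [TopologicalSpace Γ]

/-- The conjugacy class `c` satisfies `c ^ z = c`. -/
def ClassPowFixed (c : ConjClasses Γ) (z : ℤ_[p]) : Prop :=
  ∀ x ∈ c.carrier, padicPow x z ∈ c.carrier

/-- The condition that `(c, ι)` is counted by `A_Z(Γ)`: a tuple of conjugacy classes and an element
`ι` with `ι² = 1` (automatically trivial when `p` is odd). -/
structure IsLocalData {g : ℕ} (Z : Fin g → Subgroup ℤ_[p]ˣ) (c : Fin g → ConjClasses Γ)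
    (ι : Γ) : Prop where
  inv_sq : ι ^ 2 = 1
  pow_fixed : ∀ i, ∀ z ∈ Z i, ClassPowFixed (c i) (z : ℤ_[p])
  generates : Subgroup.closure (⋃ i, Abelianization.of '' (c i).carrier) = ⊤
  /-- `(w_i) ↦ ∑ w_i π(c_i)` is a well-defined isomorphism from `W(Z)` to the abelianization. -/
  iso : ∃ e : WType Z ≃+ Additive (Abelianization Γ), ∀ (w : Fin g → ℤ_[p]) (x : Fin g → Γ),
    (∀ i, x i ∈ (c i).carrier) →
      e (fun i => Ideal.Quotient.mk _ (w i)) =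
        Additive.ofMul (∏ i, Abelianization.of (padicPow (x i) (w i)))
  /-- For `p = 2`: if `t i` is the involution in the cyclic group generated by `π(c_i)`, then
  `∑ t i = π(ι)`. -/
  two : p = 2 → ∃ t : Fin g → Abelianization Γ, (∀ i, orderOf (t i) = 2) ∧
    (∀ i, ∀ x ∈ (c i).carrier, t i ∈ Subgroup.zpowers (Abelianization.of x)) ∧
    ∏ i, t i = Abelianization.of ι

/-- The number `A_Z(Γ)`. -/
def countA {g : ℕ} (Z : Fin g → Subgroup ℤ_[p]ˣ) (Γ : Type) [Group Γ] [TopologicalSpace Γ] : ℕ :=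
  Nat.card {d : (Fin g → ConjClasses Γ) × Γ // IsLocalData Z d.1 d.2}

/-- The set `Epi(F, (Γ, c))` of surjective continuous homomorphisms `F → Γ` that send
`x_{σ^m(i_j)}` into the class `c_j ^ (q ^ (-m))`, where `i_j = r j`. -/
def EpiF {N g : ℕ} (q : ℤ_[p]ˣ) (σ : Equiv.Perm (Fin N)) (r : Fin g → Fin N)
    (c : Fin g → ConjClasses Γ) : Set (F p N →ₜ* Γ) :=
  {φ | Function.Surjective φ ∧ ∀ (j : Fin g) (m : ℕ), ∃ y ∈ (c j).carrier,
    φ (gen p ((σ ^ m) (r j))) = padicPow y (((q ^ m)⁻¹ : ℤ_[p]ˣ) : ℤ_[p])}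

/-- `P_N` acts transitively on a set `X` of homomorphisms from `F` (by composition): `X` is a
single orbit. -/
def PureBraidTransitive {N : ℕ} (X : Set (F p N →ₜ* Γ)) : Prop :=
  X.Nonempty ∧ ∀ φ ∈ X, ∀ ψ ∈ X, ∃ π ∈ pureBraid p N, ψ = φ.comp (π : F p N →ₜ* F p N)

/-- Transitivity for the group `Γ` and the given `q`, `σ` and cycle representatives: for all
conjugacy classes `c_1, …, c_g` that generate `Γ` and satisfy `c_j ^ (q ^ k_j) = c_j`, the group
`P_N` acts transitively on `Epi(F, (Γ, c))`. -/
def TransitivityHypothesis {N g : ℕ} (q : ℤ_[p]ˣ) (σ : Equiv.Perm (Fin N)) (r : Fin g → Fin N)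
    (Γ : Type) [Group Γ] [TopologicalSpace Γ] : Prop :=
  ∀ c : Fin g → ConjClasses Γ,
    Subgroup.closure (⋃ j, (c j).carrier) = ⊤ →
    (∀ j, ClassPowFixed (c j) ((q : ℤ_[p]) ^ cycleLen σ (r j))) →
    PureBraidTransitive (EpiF q σ r c)

end Gamma

end RandomProP

end

/-!
The probability is computed from the expected number of surjections from `𝐆(q, σ)` to `Γ`. Surjections
`𝐆(q, σ) → Γ` are the continuous surjections `φ : F → Γ` with `φ ∘ α = φ`. The relation
`α(x_i) ∼ x_{σ(i)} ^ q` forces such a `φ` to lie in `Epi(F, (Γ, c))` for exactly one tuple `c` of classes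
generating `Γ` with `c_j ^ (q ^ k_j) = c_j`. Every `α ∈ B_N(q, σ)` preserves this set, so if `P_N` acts
transitively on it, invariance of the Haar measure shows that each of its elements is fixed by the random
`α` with probability `1 / |Epi(F, (Γ, c))|`. Each `c` therefore contributes `1` to the expectation
(`card_aut_mul_isoEvent`). For `p` odd and `Γ^ab ≅ W(q, σ)` the tuples `c` are exactly what `A_Z(Γ)` counts
(`countA_braidType_eq`): a tuple generating `Γ^ab` generates `Γ`, and the surjection `W(Z) → Γ^ab` is bijective
by comparing orders.

The number of surjections is `|Aut Γ|` if `𝐆(q, σ) ≅ Γ`; it has to be shown that it is `0` otherwise, that is,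
that a surjection `𝐆(q, σ) → Γ` is injective (`ker_eq_relSubgroup`). The abelianization of a finite quotient
`Q` of `𝐆(q, σ)` has order at most `|W(q, σ)|` (`card_abelianization_le`), so if `Q → Γ` is surjective, it
induces an isomorphism of abelianizations. If it were not injective, there would be a central extension of
`Γ` of this kind with kernel `C` of order `p`. For balanced `Γ`, the connecting map
`Hom(Γ, 𝕋) / p → H²(Γ, 𝔽_p)` of `0 → 𝔽_p → 𝕋 → 𝕋 → 0`, with `𝕋` the circle group, is an injective map of
finite sets of equal order, so that every class of `H²(Γ, 𝔽_p)` dies in `H²(Γ, 𝕋)` and the characters of `C`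
extend to the whole extension (`exists_character_extension`). But `C` lies in the commutator subgroup, a
contradiction (`injective_of_isBalanced`).

That `B_N(q, σ)` is not empty (`braidCoset_nonempty`) amounts to finding conjugates `y_i` of `x_{σ(i)} ^ q` in
`F` with `y_1 ⋯ y_N = 1`, and by compactness to finding them in finite `p`-groups. There `q` may be replaced by
a large prime `ℓ`, by Dirichlet's theorem. In the group algebra over `𝔽_ℓ`, the `ℓ`-th power of a class sum is
the sum of the class of `ℓ`-th powers (`classSum_pow`). Thus the number of solutions for the `x_{σ(i)} ^ ℓ` is
congruent modulo `ℓ` to the number of solutions for the `x_i`, which is positive and smaller than `ℓ`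
(`exists_conj_pow_prod_eq_one`).
-/

namespace RandomProP

noncomputable section

/-! ### Class sums and coprime powers in finite groups -/

section ClassSums

variable {k G : Type*} [Group G]

/-- The sum of the conjugates of `x` in the group algebra. -/
noncomputable def classSum (k : Type*) [Semiring k] [Finite G] (x : G) : MonoidAlgebra k G :=
  .ofCoeff (Finsupp.equivFunOnFinite.symm (Set.indicator {g | IsConj x g} 1))

open Classical in
lemma coeff_classSum [Semiring k] [Finite G] (x g : G) :
    (classSum k x).coeff g = if IsConj x g then 1 else 0 := by
  simp [classSum, MonoidAlgebra.coeff_ofCoeff, Set.indicator_apply]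

lemma classSum_mem_center [CommRing k] [Finite G] (x : G) :
    classSum k x ∈ Subalgebra.center k (MonoidAlgebra k G) := by
  classical
  rw [Subalgebra.mem_center_iff]
  intro b
  induction b using MonoidAlgebra.induction_linear with
  | zero => simp
  | add f g hf hg => rw [add_mul, mul_add, hf, hg]
  | single h r =>
    ext g
    rw [MonoidAlgebra.coeff_single_mul_apply, MonoidAlgebra.coeff_mul_single_apply, mul_comm,
      coeff_classSum, coeff_classSum]
    have : IsConj (h⁻¹ * g) (g * h⁻¹) := isConj_iff.2 ⟨h, by group⟩
    congr 2
    exact propext ⟨fun h' => h'.trans this, fun h' => h'.trans this.symm⟩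

lemma classSum_map {k' : Type*} [Semiring k] [Semiring k'] (f : k →+* k') [Finite G] (x : G) :
    MonoidAlgebra.mapRingHom G f (classSum k x) = classSum k' x := by
  classical
  ext g
  simp only [MonoidAlgebra.coeff_mapRingHom, coeff_classSum]
  split_ifs <;> simp

/-- In characteristic `ℓ` not dividing `|G|`, the coefficient at `1` commutes with `ℓ`-th powers:
up to the factor `|G|` it is the trace of left multiplication. -/
lemma coeff_one_pow [Finite G] (l : ℕ) [Fact l.Prime] (hl : (Nat.card G : ZMod l) ≠ 0)
    (a : MonoidAlgebra (ZMod l) G) : (a ^ l).coeff 1 = a.coeff 1 ^ l := by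
  classical
  have := Fintype.ofFinite G
  have key (b : MonoidAlgebra (ZMod l) G) :
      (Algebra.leftMulMatrix (MonoidAlgebra.basis G (ZMod l)) b).trace
        = Nat.card G * b.coeff 1 := by
    simp [Matrix.trace, Algebra.leftMulMatrix_eq_repr_mul, MonoidAlgebra.basis,
      MonoidAlgebra.coeff_mul_single_apply, Nat.card_eq_fintype_card]
  have h := ZMod.trace_pow_card (Algebra.leftMulMatrix (MonoidAlgebra.basis G (ZMod l)) a)
  rw [← map_pow, key, key, mul_pow, ZMod.pow_card] at h
  exact mul_left_cancel₀ hl h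

/-- A form of the Frobenius congruence: in characteristic `ℓ` prime to `|G|`, the `ℓ`-th power of a
class sum is the sum over the class of `ℓ`-th powers. -/
lemma classSum_pow [Finite G] (l : ℕ) [Fact l.Prime] (hl : (Nat.card G).Coprime l) (x : G) :
    classSum (ZMod l) x ^ l = classSum (ZMod l) (x ^ l) := by
  classical
  have hl0 : (Nat.card G : ZMod l) ≠ 0 := by
    rw [Ne, ZMod.natCast_eq_zero_iff]
    exact (Nat.Prime.coprime_iff_not_dvd Fact.out).1 hl.symm
  ext h
  obtain ⟨g, rfl⟩ := hl.pow_left_bijective.2 h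
  -- the coefficient of `g ^ ℓ` is read off from the `ℓ`-th power of `classSum x * g⁻¹`
  have hc : Commute (classSum (ZMod l) x) (MonoidAlgebra.single g⁻¹ 1) :=
    ((Subalgebra.mem_center_iff.1 (classSum_mem_center x)) _).symm
  have h1 := coeff_one_pow l hl0 (classSum (ZMod l) x * MonoidAlgebra.single g⁻¹ 1)
  rw [hc.mul_pow, MonoidAlgebra.single_pow] at h1
  simp only [one_pow, MonoidAlgebra.coeff_mul_single_apply, inv_inv, one_mul, mul_one,
    coeff_classSum, ZMod.pow_card, inv_pow] at h1
  rw [h1, coeff_classSum]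
  congr 1
  refine propext ⟨fun h => h.pow l, fun h => ?_⟩
  obtain ⟨c, hc⟩ := isConj_iff.1 h
  exact isConj_iff.2 ⟨c, hl.pow_left_bijective.1 (by simpa [conj_pow] using hc)⟩

lemma exists_of_coeff_prod_classSum_ne_zero [Semiring k] [Finite G] (L : List G) (h : G)
    (hL : (L.map (classSum k)).prod.coeff h ≠ 0) :
    ∃ L', List.Forall₂ IsConj L L' ∧ L'.prod = h := by
  classical
  induction L generalizing h with
  | nil =>
    refine ⟨[], .nil, ?_⟩
    by_contra hne
    refine hL ?_
    simp only [List.map_nil, List.prod_nil] at hne ⊢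
    exact Finsupp.single_eq_of_ne (Ne.symm hne)
  | cons x L ih =>
    rw [List.map_cons, List.prod_cons, MonoidAlgebra.coeff_mul_apply_left, Finsupp.sum] at hL
    obtain ⟨u, -, hu⟩ := Finset.exists_ne_zero_of_sum_ne_zero hL
    have hxu : IsConj x u := by
      by_contra hn
      exact hu (by rw [coeff_classSum, if_neg hn, zero_mul])
    obtain ⟨L', hL', hp⟩ := ih _ (right_ne_zero_of_mul hu)
    exact ⟨u :: L', .cons hxu hL', by simp [hp]⟩

lemma coeff_prod_classSum_ne_zero [Finite G] (L : List G) :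
    (L.map (classSum ℕ)).prod.coeff L.prod ≠ 0 := by
  classical
  induction L with
  | nil => simp
  | cons x L ih =>
    rw [List.map_cons, List.prod_cons, MonoidAlgebra.coeff_mul_apply_left, Finsupp.sum]
    intro h0
    rw [Finset.sum_eq_zero_iff] at h0
    have hx : (classSum ℕ x).coeff x = 1 := by
      rw [coeff_classSum, if_pos (IsConj.refl x)]
    have := h0 x (by simp [hx])
    simp [hx] at this
    exact ih this

/-- If `x₁ ⋯ x_N = 1` in a finite group and `m` is prime to the order, then there are conjugates
`y_i` of `x_{σ(i)} ^ m` with `y₁ ⋯ y_N = 1`. By Dirichlet's theorem `m` may be taken to be a large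
prime `ℓ`; then the number of solutions modulo `ℓ` is the coefficient at `1` of the `ℓ`-th power of a
product of class sums. -/
lemma exists_conj_pow_prod_eq_one [Finite G] {N : ℕ} (x : Fin N → G)
    (hx : (List.ofFn x).prod = 1) (σ : Equiv.Perm (Fin N)) (m : ℕ)
    (hm : m.Coprime (Nat.card G)) :
    ∃ y : Fin N → G, (∀ i, IsConj (x (σ i) ^ m) (y i)) ∧ (List.ofFn y).prod = 1 := by
  -- the lower bound on `ℓ` keeps the number of solutions for `x` nonzero modulo `ℓ`
  obtain ⟨l, hlt, hl, hlm⟩ := Nat.forall_exists_prime_gt_and_modEq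
    (max (Nat.card G) (((List.ofFn x).map (classSum ℕ)).prod.coeff 1)) Nat.card_pos.ne' hm
  have : Fact l.Prime := ⟨hl⟩
  have hpow (g : G) : g ^ m = g ^ l := by
    rw [pow_eq_pow_iff_modEq]
    exact (hlm.of_dvd (orderOf_dvd_natCard g)).symm
  have hcop : (Nat.card G).Coprime l := by
    rw [Nat.coprime_comm]
    refine (Nat.Prime.coprime_iff_not_dvd hl).2 fun h => ?_
    have := Nat.le_of_dvd Nat.card_pos h
    omega
  have hl0 : (Nat.card G : ZMod l) ≠ 0 := by
    rw [Ne, ZMod.natCast_eq_zero_iff]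
    exact (Nat.Prime.coprime_iff_not_dvd hl).1 hcop.symm
  -- products in the center may be reordered, which takes care of `σ`
  let K (g : G) : Subalgebra.center (ZMod l) (MonoidAlgebra (ZMod l) G) :=
    ⟨classSum (ZMod l) g, classSum_mem_center g⟩
  have hK (z : Fin N → G) : ((∏ i, K (z i) : Subalgebra.center (ZMod l) _) : MonoidAlgebra (ZMod l) G)
      = ((List.ofFn z).map (classSum (ZMod l))).prod := by
    rw [← List.prod_ofFn, List.map_ofFn]
    change (Subalgebra.center (ZMod l) (MonoidAlgebra (ZMod l) G)).val _ = _
    rw [map_list_prod, List.map_ofFn]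
    rfl
  have h1 : ((List.ofFn x).map (classSum (ZMod l))).prod.coeff 1 ≠ 0 := by
    have h2 := coeff_prod_classSum_ne_zero (List.ofFn x)
    rw [hx] at h2
    have h3 : ((List.ofFn x).map (classSum (ZMod l))).prod =
        MonoidAlgebra.mapRingHom G (Nat.castRingHom (ZMod l))
          ((List.ofFn x).map (classSum ℕ)).prod := by
      rw [map_list_prod, List.map_map]
      congr 2
      funext g
      exact (classSum_map _ g).symm
    rw [h3, MonoidAlgebra.coeff_mapRingHom]
    change ((_ : ℕ) : ZMod l) ≠ 0
    rw [Ne, ZMod.natCast_eq_zero_iff]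
    exact fun h => absurd (Nat.le_of_dvd (Nat.pos_of_ne_zero h2) h) (by omega)
  have h4 : ((List.ofFn fun i => x (σ i) ^ l).map (classSum (ZMod l))).prod =
      ((List.ofFn x).map (classSum (ZMod l))).prod ^ l := by
    rw [← hK, ← hK, ← Subalgebra.coe_pow, ← Finset.prod_pow,
      ← Equiv.prod_comp σ fun i => K (x i) ^ l]
    congr 1
    refine Finset.prod_congr rfl fun i _ => Subtype.ext ?_
    exact (classSum_pow l hcop _).symm
  obtain ⟨L', hL', hp⟩ := exists_of_coeff_prod_classSum_ne_zero (k := ZMod l)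
    (List.ofFn fun i => x (σ i) ^ l) 1 (by
      rw [h4, coeff_one_pow l hl0]
      exact pow_ne_zero _ h1)
  obtain ⟨hlen, hc⟩ := List.forall₂_iff_get.1 hL'
  rw [List.length_ofFn] at hlen
  subst hlen
  refine ⟨fun i => L'.get i, fun i => ?_, by rw [List.ofFn_get, hp]⟩
  have := hc i (by simp) i.2
  simpa [hpow] using this

end ClassSums

/-! ### Central extensions of balanced groups -/

section Balanced

lemma exists_toCircle_eq {p : ℕ} [NeZero p] {z : Circle} (hz : z ^ p = 1) :
    ∃ a : ZMod p, ZMod.toCircle a = z := by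
  have h : Circle.toUnits z ∈ rootsOfUnity p ℂ := by
    rw [mem_rootsOfUnity, ← map_pow, hz, map_one]
  obtain ⟨i, -, hi⟩ := (Complex.mem_rootsOfUnity p _).1 h
  refine ⟨(i : ZMod p), Circle.ext ?_⟩
  rw [ZMod.toCircle_natCast]
  rw [Circle.toUnits_apply, Units.val_mk0] at hi
  rw [← hi]
  congr 1
  ring

variable {p : ℕ} [Fact p.Prime]

lemma toCircle_pow (a : ZMod p) : ZMod.toCircle a ^ p = 1 := by
  rw [← AddChar.map_nsmul_eq_pow]
  simp

lemma exists_circle_root (n : ℕ) (hn : n ≠ 0) (z : Circle) : ∃ w : Circle, w ^ n = z := by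
  refine ⟨Circle.exp (Complex.arg z / n), ?_⟩
  rw [← Circle.exp_natCast_mul, mul_div_cancel₀ _ (by exact_mod_cast hn), Circle.exp_arg]

lemma finite_circleHom (Γ : Type*) [Group Γ] [Finite Γ] : Finite (Γ →* Circle) := by
  obtain ⟨n, hn, hn0⟩ : ∃ n, (∀ g : Γ, g ^ n = 1) ∧ n ≠ 0 :=
    ⟨Nat.card Γ, fun _ => pow_card_eq_one', Nat.card_pos.ne'⟩
  have : NeZero n := ⟨hn0⟩
  choose a ha using fun (χ : Γ →* Circle) (g : Γ) =>
    exists_toCircle_eq (p := n) (z := χ g) (by rw [← map_pow, hn, map_one])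
  refine Finite.of_injective a fun χ χ' h => MonoidHom.ext fun g => ?_
  rw [← ha χ g, ← ha χ' g, h]

variable {Γ : Type} [Group Γ] 

lemma mem_cocycles_trivial_iff (f : Γ × Γ → ZMod p) :
    f ∈ groupCohomology.cocycles₂ (Rep.trivial (ZMod p) Γ (ZMod p)) ↔
      ∀ g h j, f (g * h, j) + f (g, h) = f (h, j) + f (g, h * j) :=
  groupCohomology.mem_cocycles₂_iff _

lemma mem_coboundaries_trivial_iff (f : Γ × Γ → ZMod p) :
    f ∈ groupCohomology.coboundaries₂ (Rep.trivial (ZMod p) Γ (ZMod p)) ↔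
      ∃ b : Γ → ZMod p, ∀ g h, f (g, h) = b h - b (g * h) + b g :=
  ⟨fun ⟨b, hb⟩ => ⟨b, fun g h => (congrFun hb (g, h)).symm⟩,
    fun ⟨b, hb⟩ => ⟨b, funext fun g => (hb g.1 g.2).symm⟩⟩

/-- The number of characters of `Γ` of exponent `p` is `|H¹(Γ, 𝔽_p)|`. -/
lemma card_ker_pow_eq [Finite Γ] :
    Nat.card (powMonoidHom p : (Γ →* Circle) →* (Γ →* Circle)).ker =
      p ^ Module.finrank (ZMod p) (groupCohomology (Rep.trivial (ZMod p) Γ (ZMod p)) 1) := by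
  have e : groupCohomology (Rep.trivial (ZMod p) Γ (ZMod p)) 1 ≃ₗ[ZMod p] (Additive Γ →+ ZMod p) :=
    (groupCohomology.H1IsoOfIsTrivial (Rep.trivial (ZMod p) Γ (ZMod p))).toLinearEquiv
  have hfin : Finite (Additive Γ →+ ZMod p) := DFunLike.finite _
  rw [e.finrank_eq]
  have h := Module.natCard_eq_pow_finrank (K := ZMod p) (V := Additive Γ →+ ZMod p)
  rw [Nat.card_zmod] at h
  rw [← h]
  symm
  let T (f : Additive Γ →+ ZMod p) : Γ →* Circle :=
    MonoidHom.mk' (fun g => ZMod.toCircle (f (Additive.ofMul g))) fun g h => by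
      rw [ofMul_mul, map_add, AddChar.map_add_eq_mul]
  refine Nat.card_congr (Equiv.ofBijective
    (fun f => ⟨T f, MonoidHom.ext fun g => toCircle_pow _⟩) ⟨?_, ?_⟩)
  · intro f f' h
    ext g
    exact ZMod.injective_toCircle (DFunLike.congr_fun (Subtype.ext_iff.1 h) g)
  · rintro ⟨χ, hχ⟩
    choose f hf using fun g : Γ => exists_toCircle_eq (p := p) (DFunLike.congr_fun hχ g)
    refine ⟨AddMonoidHom.mk' (fun g => f (Additive.toMul g)) fun g h => ?_, Subtype.ext
      (MonoidHom.ext fun g => hf g)⟩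
    apply ZMod.injective_toCircle
    rw [AddChar.map_add_eq_mul, hf, hf, hf, toMul_add, map_mul]

/-- Every class in `H²(Γ, 𝔽_p)` of a balanced group becomes trivial with values in the circle group:
the connecting map `Hom(Γ, 𝕋) / p → H²(Γ, 𝔽_p)` is injective, and both sides have the same order. -/
lemma exists_circle_splitting [Finite Γ] (hbal : IsBalanced p Γ) (f : Γ × Γ → ZMod p)
    (hf : ∀ g h j, f (g * h, j) + f (g, h) = f (h, j) + f (g, h * j)) :
    ∃ u : Γ → Circle, ∀ g h, ZMod.toCircle (f (g, h)) = u g * u h / u (g * h) := by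
  have := finite_circleHom Γ
  let A := Rep.trivial (ZMod p) Γ (ZMod p)
  -- `f` is the image of `χ` under the connecting map: the factor set of a `p`-th root `s` of `χ`
  have key (χ : Γ →* Circle) : ∃ (s : Γ → Circle) (f : groupCohomology.cocycles₂ A),
      (∀ g, s g ^ p = χ g) ∧ ∀ g h, ZMod.toCircle (f.1 (g, h)) = s g * s h / s (g * h) := by
    choose s hs using fun g => exists_circle_root p (Fact.out : p.Prime).ne_zero (χ g)
    choose f hf using fun x : Γ × Γ => exists_toCircle_eq (p := p)
      (z := s x.1 * s x.2 / s (x.1 * x.2)) (by simp [div_pow, mul_pow, hs])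
    refine ⟨s, ⟨f, (mem_cocycles_trivial_iff f).2 fun g h j => ?_⟩, hs, fun g h => hf (g, h)⟩
    apply ZMod.injective_toCircle
    simp only [AddChar.map_add_eq_mul, hf]
    rw [div_mul_div_comm, div_mul_div_comm, div_eq_div_iff_mul_eq_mul, mul_assoc g h j]
    generalize s (g * (h * j)) = a, s (g * h) = b, s (h * j) = c
    simp only [mul_comm, mul_left_comm]
  choose s F hs hF using key
  let Φ (χ : Γ →* Circle) : groupCohomology A 2 := groupCohomology.H2π A (F χ)
  have hΦ (χ χ' : Γ →* Circle) (h : Φ χ = Φ χ') :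
      χ / χ' ∈ (powMonoidHom p : (Γ →* Circle) →* (Γ →* Circle)).range := by
    obtain ⟨b, hb⟩ := (mem_coboundaries_trivial_iff _).1 ((groupCohomology.H2π_eq_iff _ _).1 h)
    refine ⟨MonoidHom.mk' (fun g => s χ g / s χ' g / ZMod.toCircle (b g)) fun g h => ?_,
      MonoidHom.ext fun g => ?_⟩
    · have h1 := congrArg ZMod.toCircle (hb g h)
      change ZMod.toCircle ((F χ).1 (g, h) - (F χ').1 (g, h)) = _ at h1
      rw [AddChar.map_add_eq_mul, AddChar.map_sub_eq_div, AddChar.map_sub_eq_div, hF, hF] at h1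
      have h2 {D : Type} [AddCommGroup D] {a b c a' b' c' x y z : D}
          (h : a + b - c - (a' + b' - c') = y - z + x) :
          c - c' - z = a - a' - x + (b - b' - y) := by grind
      exact h2 (D := Additive Circle) h1
    · change (s χ g / s χ' g / ZMod.toCircle (b g)) ^ p = χ g / χ' g
      rw [div_pow, div_pow, hs, hs, toCircle_pow, div_one]
  have hfin2 : Module.Finite (ZMod p) (groupCohomology A 2) :=
    Module.Finite.of_surjective (groupCohomology.H2π A).hom
      ((ModuleCat.epi_iff_surjective _).1 inferInstance)
  have hfin2' : Finite (groupCohomology A 2) := Module.finite_of_finite (ZMod p)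
  let P := (powMonoidHom p : (Γ →* Circle) →* (Γ →* Circle))
  -- `|Hom(Γ, 𝕋) / p| = |Hom(Γ, 𝕋)[p]| = |H¹| = |H²|`, so the injection is onto
  have hinj : Function.Injective fun c : (Γ →* Circle) ⧸ P.range => Φ c.out := by
    intro c c' h
    rw [← QuotientGroup.out_eq' c, ← QuotientGroup.out_eq' c', QuotientGroup.eq_iff_div_mem]
    exact hΦ _ _ h
  have hcard : Nat.card (groupCohomology A 2) = Nat.card ((Γ →* Circle) ⧸ P.range) := by
    have h1 := Subgroup.card_eq_card_quotient_mul_card_subgroup P.range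
    have h2 := P.ker.index_mul_card
    rw [Subgroup.index_ker, h1, mul_comm, card_ker_pow_eq] at h2
    rw [Module.natCard_eq_pow_finrank (K := ZMod p), Nat.card_zmod, ← hbal]
    exact Nat.eq_of_mul_eq_mul_right Nat.card_pos h2
  obtain ⟨c, hc⟩ := (hinj.bijective_of_nat_card_le hcard.le).2
    (groupCohomology.H2π A ⟨f, (mem_cocycles_trivial_iff f).2 hf⟩)
  obtain ⟨b, hb⟩ := (mem_coboundaries_trivial_iff _).1 ((groupCohomology.H2π_eq_iff _ _).1 hc)
  refine ⟨fun g => s c.out g / ZMod.toCircle (b g), fun g h => ?_⟩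
  have h1 := congrArg ZMod.toCircle (hb g h)
  change ZMod.toCircle ((F c.out).1 (g, h) - f (g, h)) = _ at h1
  rw [AddChar.map_add_eq_mul, AddChar.map_sub_eq_div, AddChar.map_sub_eq_div, hF] at h1
  have h2 {D : Type} [AddCommGroup D] {a b c w x y z : D}
      (h : a + b - c - w = y - z + x) : w = a - x + (b - y) - (c - z) := by grind
  exact h2 (D := Additive Circle) h1

/-- Characters of exponent `p` of the kernel of a central extension of a balanced group extend to the
whole group. -/
lemma exists_character_extension [Finite Γ] (hbal : IsBalanced p Γ) {E : Type*} [Group E]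
    (π : E →* Γ) (hπ : Function.Surjective π) (hc : π.ker ≤ Subgroup.center E)
    (ε : π.ker →* Circle) (hε : ∀ x, ε x ^ p = 1) :
    ∃ ε' : E →* Circle, ∀ x : π.ker, ε' x = ε x := by
  choose t ht using hπ
  have hcomm (k : π.ker) (e : E) : e * k = k * e := Subgroup.mem_center_iff.1 (hc k.2) e
  -- the factor set of the section `t`
  let c (g h : Γ) : π.ker := ⟨t g * t h * (t (g * h))⁻¹, by simp [MonoidHom.mem_ker, ht]⟩
  have hcc (g h j : Γ) : c (g * h) j * c g h = c h j * c g (h * j) := by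
    refine Subtype.ext ?_
    rw [Subgroup.coe_mul, Subgroup.coe_mul, hcomm (c g h)]
    have h1 : (c h j * c g (h * j) : E) = t g * c h j * (t (h * j) * (t (g * (h * j)))⁻¹) := by
      rw [hcomm (c h j)]
      simp only [c, mul_assoc]
    rw [h1]
    simp only [c]
    rw [mul_assoc g h j]
    group
  choose f hf using fun x : Γ × Γ => exists_toCircle_eq (p := p) (hε (c x.1 x.2))
  obtain ⟨u, hu⟩ := exists_circle_splitting hbal f fun g h j => by
    apply ZMod.injective_toCircle
    simp only [AddChar.map_add_eq_mul, hf, ← map_mul, hcc]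
  simp only [hf] at hu
  -- `e = k e * t (π e)` is the decomposition of `e` given by the section
  let k (e : E) : π.ker := ⟨e * (t (π e))⁻¹, by simp [MonoidHom.mem_ker, ht]⟩
  have hk (e e' : E) : k (e * e') = k e * k e' * c (π e) (π e') := by
    refine Subtype.ext ?_
    rw [mul_assoc, Subgroup.coe_mul, Subgroup.coe_mul]
    have h1 : (k e' * c (π e) (π e') : E) = t (π e) * k e' * (t (π e') * (t (π e * π e'))⁻¹) := by
      rw [hcomm (k e')]
      simp only [c, mul_assoc]
    rw [h1]
    simp only [k, map_mul]
    group
  refine ⟨MonoidHom.mk' (fun e => ε (k e) * u (π e)) fun e e' => ?_, fun x => ?_⟩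
  · rw [hk, map_mul, map_mul, hu, map_mul]
    have h2 {D : Type} [AddCommGroup D] {a b x y z : D} :
        a + b + (x + y - z) + z = a + x + (b + y) := by grind
    exact h2 (D := Additive Circle)
  · have hx : π x = 1 := x.2
    have h1 := hu 1 1
    rw [mul_one, mul_div_assoc, div_self', mul_one] at h1
    have h2 : k x * c 1 1 = x := Subtype.ext (by simp [k, c, hx])
    change ε (k x) * u (π x) = ε x
    rw [hx, ← h1, ← map_mul, h2]

lemma abelianization_map_surjective {Q Q' : Type*} [Group Q] [Group Q'] {f : Q →* Q'}
    (hf : Function.Surjective f) : Function.Surjective (Abelianization.map f) := by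
  intro y
  obtain ⟨y, rfl⟩ := QuotientGroup.mk_surjective y
  obtain ⟨x, rfl⟩ := hf y
  exact ⟨Abelianization.of x, Abelianization.map_of f x⟩

/-- A nontrivial normal subgroup of a finite `p`-group contains a central element of order `p`. -/
lemma exists_central_orderOf_eq {Q : Type*} [Group Q] [Finite Q] (hQ : IsPGroup p Q)
    (K : Subgroup Q) [K.Normal] (hK : K ≠ ⊥) :
    ∃ z ∈ K, z ∈ Subgroup.center Q ∧ orderOf z = p := by
  have hnt : Nontrivial K := (Subgroup.nontrivial_iff_ne_bot K).2 hK
  have hdvd : p ∣ Nat.card K := by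
    obtain ⟨n, hn0, hn⟩ := (hQ.to_subgroup K).nontrivial_iff_card.mp hnt
    exact hn.symm ▸ dvd_pow_self _ hn0.ne'
  obtain ⟨b, hb, hb1⟩ :=
    (hQ.of_equiv ConjAct.toConjAct).exists_fixed_point_of_prime_dvd_card_of_fixed_point K hdvd
      (a := 1) (fun g => smul_one g)
  have hbc : (b : Q) ∈ Subgroup.center Q := by
    rw [Subgroup.mem_center_iff]
    intro g
    have h1 := congrArg Subtype.val (hb (ConjAct.toConjAct g))
    rw [ConjAct.Subgroup.val_conj_smul, ConjAct.smul_def, ConjAct.ofConjAct_toConjAct] at h1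
    exact mul_inv_eq_iff_eq_mul.1 h1
  obtain ⟨n, hn⟩ := (IsPGroup.iff_orderOf.1 hQ) (b : Q)
  have hn0 : n ≠ 0 := by
    rintro rfl
    rw [pow_zero, orderOf_eq_one_iff] at hn
    exact hb1 (Subtype.ext hn.symm)
  obtain ⟨m, rfl⟩ := Nat.exists_eq_succ_of_ne_zero hn0
  refine ⟨(b : Q) ^ p ^ m, pow_mem b.2 _, pow_mem hbc _, ?_⟩
  rw [orderOf_pow_of_dvd (pow_ne_zero _ (Fact.out : p.Prime).ne_zero), hn, pow_succ,
    Nat.mul_div_cancel_left _ (pow_pos (Fact.out : p.Prime).pos _)]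
  rw [hn]
  exact pow_dvd_pow _ m.le_succ

/-- A balanced `p`-group has no proper extension by a finite `p`-group with the same
abelianization. -/
theorem injective_of_isBalanced [Finite Γ] (hbal : IsBalanced p Γ) {Q : Type} [Group Q] [Finite Q]
    (hQ : IsPGroup p Q) (π : Q →* Γ) (hπ : Function.Surjective π)
    (hab : Nat.card (Abelianization Q) ≤ Nat.card (Abelianization Γ)) :
    Function.Injective π := by
  induction hn : Nat.card Q using Nat.strong_induction_on generalizing Q with
  | _ n ih =>
  subst hn
  rw [← MonoidHom.ker_eq_bot_iff]
  by_contra hK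
  obtain ⟨z, hzK, hzc, hzp⟩ := exists_central_orderOf_eq hQ π.ker hK
  let C := Subgroup.zpowers z
  have hCc : C ≤ Subgroup.center Q := by rwa [Subgroup.zpowers_le]
  have hCK : C ≤ π.ker := by rwa [Subgroup.zpowers_le]
  have hCn : C.Normal := ⟨fun x hx g => by
    rw [Subgroup.mem_center_iff.1 (hCc hx) g, mul_inv_cancel_right]
    exact hx⟩
  have hCcard : Nat.card C = p := by rw [Nat.card_zpowers, hzp]
  have hlt : Nat.card (Q ⧸ C) < Nat.card Q := by
    rw [Subgroup.card_eq_card_quotient_mul_card_subgroup C, hCcard]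
    exact lt_mul_of_one_lt_right Nat.card_pos (Fact.out : p.Prime).one_lt
  -- by induction the kernel is central of order `p`
  have hinj := ih _ hlt (Q := Q ⧸ C) (hQ.to_quotient C) (QuotientGroup.lift C π hCK)
    (QuotientGroup.lift_surjective_of_surjective C π hπ hCK) (by
      refine le_trans (Nat.card_le_card_of_surjective
        (Abelianization.map (QuotientGroup.mk' C))
          (abelianization_map_surjective (QuotientGroup.mk'_surjective C))) hab) rfl
  have hKC : π.ker = C := by
    refine le_antisymm (fun x hx => ?_) hCK
    rw [← QuotientGroup.eq_one_iff]
    apply hinj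
    rw [map_one]
    exact hx
  have e : π.ker ≃* Multiplicative (ZMod p) := mulEquivOfPrimeCardEq (p := p)
    (by rw [hKC, hCcard]) (by simp)
  let ε : π.ker →* Circle := (ZMod.toCircle (N := p)).toMonoidHom.comp e.toMonoidHom
  obtain ⟨ε', hε'⟩ := exists_character_extension hbal π hπ (hKC ▸ hCc) ε
    fun x => toCircle_pow (p := p) _
  have habinj : Function.Injective (Abelianization.map π) := by
    have hs := abelianization_map_surjective hπ
    exact (hs.bijective_of_nat_card_le hab).1
  have hz1 : Abelianization.of z = 1 := by
    apply habinj
    rw [Abelianization.map_of, map_one, hzK, map_one]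
  have h1 : ε' z = 1 := by
    rw [← Abelianization.lift_apply_of ε' z, hz1, map_one]
  have h2 : ε ⟨z, hzK⟩ = ε 1 := by rw [map_one, ← h1, ← hε']
  have h3 : (⟨z, hzK⟩ : π.ker) = 1 := e.injective (ZMod.injective_toCircle h2)
  have h4 : z = 1 := congrArg Subtype.val h3
  rw [h4, orderOf_one] at hzp
  exact (Fact.out : p.Prime).one_lt.ne hzp

end Balanced

/-! ### `ℤ_p`-powers -/

section PadicPow

lemma pow_eq_pow_of_modEq {G : Type*} [Group G] {p : ℕ} {x : G} {n a b : ℕ}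
    (hx : x ^ p ^ n = 1) (h : a ≡ b [MOD p ^ n]) :
    x ^ a = x ^ b :=
  pow_eq_pow_iff_modEq.2 (h.of_dvd (orderOf_dvd_of_pow_eq_one hx))

variable {p : ℕ} [Fact p.Prime]

lemma sub_appr_mem (z : ℤ_[p]) {m n : ℕ} (h : n ≤ m) :
    z - (z.appr m : ℤ_[p]) ∈ Ideal.span {(p : ℤ_[p]) ^ n} :=
  Ideal.span_singleton_le_span_singleton.2 (pow_dvd_pow _ h) (PadicInt.appr_spec m z)

lemma natCast_sub_mem_iff {a b n : ℕ} :
    (a : ℤ_[p]) - b ∈ Ideal.span {(p : ℤ_[p]) ^ n} ↔ a ≡ b [MOD p ^ n] := by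
  rw [← PadicInt.ker_toZModPow, RingHom.mem_ker, map_sub, map_natCast, map_natCast, sub_eq_zero,
    ZMod.natCast_eq_natCast_iff]

section Discrete

variable {G : Type*} [Group G] [TopologicalSpace G] [DiscreteTopology G]

/-- In a discrete group `ℤ_p`-powers of an element of order dividing `p ^ n` are ordinary powers, with
the exponent modulo `p ^ n`. -/
lemma padicPow_eq_pow {x : G} {n : ℕ} (hx : x ^ p ^ n = 1) {z : ℤ_[p]} {m : ℕ}
    (h : z - m ∈ Ideal.span {(p : ℤ_[p]) ^ n}) : padicPow x z = x ^ m := by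
  refine Tendsto.limUnder_eq (tendsto_const_nhds.congr' ?_)
  filter_upwards [eventually_ge_atTop n] with k hk
  refine pow_eq_pow_of_modEq hx (natCast_sub_mem_iff.1 ?_)
  have := Ideal.sub_mem _ (sub_appr_mem z hk) h
  rwa [sub_sub_sub_cancel_left] at this

lemma padicPow_natCast (hG : IsPGroup p G) (x : G) (m : ℕ) : padicPow x (m : ℤ_[p]) = x ^ m := by
  obtain ⟨n, hn⟩ := hG x
  exact padicPow_eq_pow hn (by simp)

lemma padicPow_one (hG : IsPGroup p G) (x : G) : padicPow x (1 : ℤ_[p]) = x := by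
  simpa using padicPow_natCast hG x 1

lemma exists_padicPow_eq (hG : IsPGroup p G) (x : G) (z : ℤ_[p]) :
    ∃ m : ℕ, padicPow x z = x ^ m := by
  obtain ⟨n, hn⟩ := hG x
  exact ⟨_, padicPow_eq_pow hn (sub_appr_mem z le_rfl)⟩

lemma padicPow_padicPow (hG : IsPGroup p G) (x : G) (z w : ℤ_[p]) :
    padicPow (padicPow x z) w = padicPow x (z * w) := by
  obtain ⟨n, hn⟩ := hG x
  have hz := sub_appr_mem z (le_refl n)
  have hw := sub_appr_mem w (le_refl n)
  rw [padicPow_eq_pow hn hz, padicPow_eq_pow (by rw [← pow_mul, mul_comm, pow_mul, hn, one_pow]) hw,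
    ← pow_mul]
  refine (padicPow_eq_pow hn ?_).symm
  push_cast
  have : z * w - z.appr n * w.appr n = w * (z - z.appr n) + z.appr n * (w - w.appr n) := by ring
  rw [this]
  exact Ideal.add_mem _ (Ideal.mul_mem_left _ _ hz) (Ideal.mul_mem_left _ _ hw)

lemma map_padicPow_discrete {H : Type*} [Group H] [TopologicalSpace H] [DiscreteTopology H]
    (hG : IsPGroup p G) (f : G →* H) (x : G) (z : ℤ_[p]) :
    f (padicPow x z) = padicPow (f x) z := by
  obtain ⟨n, hn⟩ := hG x
  have hz := sub_appr_mem z (le_refl n)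
  rw [padicPow_eq_pow hn hz, padicPow_eq_pow (by rw [← map_pow, hn, map_one]) hz, map_pow]

lemma IsConj.padicPow (hG : IsPGroup p G) {x y : G} (h : IsConj x y) (z : ℤ_[p]) :
    IsConj (padicPow x z) (padicPow y z) := by
  obtain ⟨c, rfl⟩ := isConj_iff.1 h
  have := map_padicPow_discrete hG (MulAut.conj c).toMonoidHom x z
  exact isConj_iff.2 ⟨c, this⟩

end Discrete

/-! ### Abelian `p`-groups as quotients of sums of quotients of `ℤ_p` -/

section Abelian

variable {A : Type*} [AddCommGroup A]

lemma zmultiplesHom_natCast_eq_zero {n : ℕ} {a : A} (ha : n • a = 0) :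
    zmultiplesHom A a (n : ℤ) = 0 := by
  rw [zmultiplesHom_apply, natCast_zsmul, ha]

/-- The homomorphism `z ↦ z • a` from `ℤ_p`, for `a` killed by `p ^ n`. -/
noncomputable def padicSMul {n : ℕ} {a : A} (ha : p ^ n • a = 0) : ℤ_[p] →+ A :=
  (ZMod.lift (p ^ n) ⟨zmultiplesHom A a, zmultiplesHom_natCast_eq_zero ha⟩).comp
    (PadicInt.toZModPow n : ℤ_[p] →+* ZMod (p ^ n)).toAddMonoidHom

lemma padicSMul_eq {n : ℕ} {a : A} (ha : p ^ n • a = 0) {z : ℤ_[p]} {m : ℕ}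
    (h : z - m ∈ Ideal.span {(p : ℤ_[p]) ^ n}) : padicSMul ha z = m • a := by
  rw [← PadicInt.ker_toZModPow, RingHom.mem_ker, map_sub, map_natCast, sub_eq_zero] at h
  change ZMod.lift (p ^ n) ⟨zmultiplesHom A a, zmultiplesHom_natCast_eq_zero ha⟩
    (PadicInt.toZModPow n z) = _
  rw [h]
  have := ZMod.lift_coe (p ^ n) ⟨zmultiplesHom A a, zmultiplesHom_natCast_eq_zero ha⟩ (m : ℤ)
  rw [Int.cast_natCast] at this
  rw [this]
  simp

lemma padicSMul_mul {n : ℕ} {a : A} (ha : p ^ n • a = 0) (z w : ℤ_[p]) :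
    padicSMul ha (z * w) = z.appr n • padicSMul ha w := by
  have hz := sub_appr_mem z (le_refl n)
  have hw := sub_appr_mem w (le_refl n)
  rw [padicSMul_eq ha hw, ← mul_smul]
  refine padicSMul_eq ha ?_
  push_cast
  have : z * w - z.appr n * w.appr n = w * (z - z.appr n) + z.appr n * (w - w.appr n) := by ring
  rw [this]
  exact Ideal.add_mem _ (Ideal.mul_mem_left _ _ hz) (Ideal.mul_mem_left _ _ hw)

/-- Elements `a_j` killed by `u_j ∈ ℤ_p` define a homomorphism from the product of the groups
`ℤ_p / u_j`. -/
lemma exists_hom_of_quotients {n g : ℕ} (a : Fin g → A) (ha : ∀ j, p ^ n • a j = 0)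
    (u : Fin g → ℤ_[p]) (hu : ∀ j, padicSMul (ha j) (u j) = 0) :
    ∃ f : (∀ j, ℤ_[p] ⧸ Ideal.span {u j}) →+ A, ∀ w : Fin g → ℤ_[p],
      f (fun j => Ideal.Quotient.mk _ (w j)) = ∑ j, padicSMul (ha j) (w j) := by
  have hI (j : Fin g) : (Ideal.span {u j}).toAddSubgroup ≤ (padicSMul (ha j)).ker := by
    intro x hx
    obtain ⟨y, rfl⟩ := Ideal.mem_span_singleton'.1 hx
    rw [AddMonoidHom.mem_ker, padicSMul_mul, hu, smul_zero]
  refine ⟨∑ j, (QuotientAddGroup.lift _ (padicSMul (ha j)) (hI j)).comp (Pi.evalAddMonoidHom _ j),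
    fun w => ?_⟩
  rw [AddMonoidHom.finsetSum_apply]
  rfl

lemma exists_surjective_of_quotients {n g : ℕ} (a : Fin g → A) (ha : ∀ j, p ^ n • a j = 0)
    (u : Fin g → ℤ_[p]) (hu : ∀ j, padicSMul (ha j) (u j) = 0)
    (hgen : AddSubgroup.closure (Set.range a) = ⊤) :
    ∃ f : (∀ j, ℤ_[p] ⧸ Ideal.span {u j}) →+ A, Function.Surjective f ∧ ∀ w : Fin g → ℤ_[p],
      f (fun j => Ideal.Quotient.mk _ (w j)) = ∑ j, padicSMul (ha j) (w j) := by
  obtain ⟨f, hf⟩ := exists_hom_of_quotients a ha u hu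
  refine ⟨f, ?_, hf⟩
  rw [← AddMonoidHom.range_eq_top, eq_top_iff, ← hgen, AddSubgroup.closure_le]
  rintro _ ⟨j, rfl⟩
  refine ⟨_, (hf (Pi.single j 1)).trans ?_⟩
  rw [Finset.sum_eq_single j]
  · rw [Pi.single_eq_same, padicSMul_eq (m := 1) _ (by simp), one_smul]
  · intro i _ hi
    rw [Pi.single_eq_of_ne hi, map_zero]
  · simp

end Abelian

end PadicPow

/-! ### Local data and generating tuples of conjugacy classes -/

section LocalData

variable {p : ℕ} [Fact p.Prime]

/-- A normal subgroup of a finite `p`-group that surjects onto the abelianization is everything. -/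
lemma eq_top_of_map_abelianization {Γ : Type*} [Group Γ] [Finite Γ] (hΓ : IsPGroup p Γ)
    (H : Subgroup Γ) [H.Normal] (h : H.map Abelianization.of = ⊤) : H = ⊤ := by
  by_contra hH
  have : Nontrivial (Γ ⧸ H) := by
    rw [← not_subsingleton_iff_nontrivial, QuotientGroup.subsingleton_iff]
    exact hH
  have hnil := (hΓ.to_quotient H).isNilpotent
  refine (Group.IsSolvable.commutator_lt_top_of_nontrivial (Γ ⧸ H)).ne (eq_top_iff.2 fun y _ => ?_)
  obtain ⟨x, rfl⟩ := QuotientGroup.mk_surjective y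
  obtain ⟨z, hz, hzx⟩ : Abelianization.of x ∈ H.map Abelianization.of := h ▸ Subgroup.mem_top _
  have h1 : z⁻¹ * x ∈ commutator Γ := QuotientGroup.eq.1 hzx
  have h2 : (QuotientGroup.mk x : Γ ⧸ H) = QuotientGroup.mk' H (z⁻¹ * x) := by
    have h3 : QuotientGroup.mk' H z⁻¹ = 1 := (QuotientGroup.eq_one_iff _).2 (inv_mem hz)
    rw [map_mul, h3, one_mul]
    rfl
  rw [h2]
  have h3 := Subgroup.mem_map_of_mem (QuotientGroup.mk' H) h1
  rw [commutator_def, Subgroup.map_commutator] at h3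
  exact Subgroup.commutator_mono le_top le_top h3

section Conj

variable {G : Type*} [Group G] [TopologicalSpace G] [DiscreteTopology G]
  {N : ℕ} {q : ℤ_[p]ˣ} {σ : Equiv.Perm (Fin N)} {x : Fin N → G}

/-- Iterating `x_i ∼ x_{σ(i)} ^ q`. -/
lemma isConj_padicPow_iterate (hG : IsPGroup p G)
    (hx : ∀ i, IsConj (x i) (padicPow (x (σ i)) (q : ℤ_[p]))) (m : ℕ) (i : Fin N) :
    IsConj (x i) (padicPow (x ((σ ^ m) i)) ((q : ℤ_[p]) ^ m)) := by
  induction m with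
  | zero =>
    rw [pow_zero, pow_zero, padicPow_one hG]
    exact IsConj.refl _
  | succ m ih =>
    refine ih.trans ?_
    have h := IsConj.padicPow hG (hx ((σ ^ m) i)) ((q : ℤ_[p]) ^ m)
    rwa [padicPow_padicPow hG, ← pow_succ', ← Equiv.Perm.mul_apply, ← pow_succ'] at h

lemma isConj_padicPow_iterate_inv (hG : IsPGroup p G)
    (hx : ∀ i, IsConj (x i) (padicPow (x (σ i)) (q : ℤ_[p]))) (m : ℕ) (i : Fin N) :
    IsConj (x ((σ ^ m) i)) (padicPow (x i) (((q ^ m)⁻¹ : ℤ_[p]ˣ) : ℤ_[p])) := by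
  have h := IsConj.padicPow hG (isConj_padicPow_iterate hG hx m i) (((q ^ m)⁻¹ : ℤ_[p]ˣ) : ℤ_[p])
  rw [padicPow_padicPow hG, ← Units.val_pow_eq_pow_val, Units.mul_inv, padicPow_one hG] at h
  exact h.symm

lemma pow_cycleLen_apply (σ : Equiv.Perm (Fin N)) (i : Fin N) : (σ ^ cycleLen σ i) i = i := by
  have := Function.isPeriodicPt_minimalPeriod σ i
  rwa [Function.IsPeriodicPt, Function.IsFixedPt, Equiv.Perm.iterate_eq_pow] at this

lemma isConj_padicPow_cycleLen (hG : IsPGroup p G)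
    (hx : ∀ i, IsConj (x i) (padicPow (x (σ i)) (q : ℤ_[p]))) (i : Fin N) :
    IsConj (x i) (padicPow (x i) ((q : ℤ_[p]) ^ cycleLen σ i)) := by
  have h := isConj_padicPow_iterate hG hx (cycleLen σ i) i
  rwa [pow_cycleLen_apply] at h

end Conj

lemma IsCycleReps.exists_pow_eq {N g : ℕ} {σ : Equiv.Perm (Fin N)} {r : Fin g → Fin N}
    (hr : IsCycleReps σ r) (i : Fin N) : ∃ j, ∃ m : ℕ, (σ ^ m) (r j) = i := by
  obtain ⟨j, hj, -⟩ := hr i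
  obtain ⟨m, -, hm⟩ := hj.exists_pow_eq'
  exact ⟨j, m, hm⟩

lemma of_eq_of_isConj {Q : Type*} [Group Q] {x y : Q} (h : IsConj x y) :
    Abelianization.of x = Abelianization.of y :=
  isConj_iff_eq.1 (MonoidHom.map_isConj Abelianization.of h)

lemma padicSMul_of {G : Type*} [Group G] [TopologicalSpace G] [DiscreteTopology G] {x : G} {n : ℕ}
    (hx : x ^ p ^ n = 1) (ha : p ^ n • Additive.ofMul (Abelianization.of x) = 0) (z : ℤ_[p]) :
    padicSMul ha z = Additive.ofMul (Abelianization.of (padicPow x z)) := by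
  have hz := sub_appr_mem z (le_refl n)
  rw [padicSMul_eq ha hz, padicPow_eq_pow hx hz, map_pow, ofMul_pow]

lemma nsmul_of_eq_zero {G : Type*} [Group G] {n : ℕ} (hn : ∀ x : G, x ^ n = 1) (x : G) :
    n • Additive.ofMul (Abelianization.of x) = 0 := by
  rw [← ofMul_pow, ← map_pow, hn, map_one, ofMul_one]

lemma exists_pow_prime_pow_eq_one {G : Type*} [Group G] [Finite G] (hG : IsPGroup p G) :
    ∃ n, ∀ x : G, x ^ p ^ n = 1 := by
  obtain ⟨n, hn⟩ := IsPGroup.iff_card.1 hG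
  exact ⟨n, fun x => by rw [← hn, pow_card_eq_one']⟩

lemma eq_top_of_forall_of_mem {G : Type*} [Group G] {s : Set G} (hs : Subgroup.closure s = ⊤)
    {H : AddSubgroup (Additive (Abelianization G))}
    (h : ∀ x ∈ s, Additive.ofMul (Abelianization.of x) ∈ H) : H = ⊤ := by
  refine (AddSubgroup.eq_top_iff' H).2 fun y => ?_
  obtain ⟨y, rfl⟩ := Additive.ofMul.surjective y
  obtain ⟨x, rfl⟩ := QuotientGroup.mk_surjective y
  change Additive.ofMul (Abelianization.of x) ∈ H
  have hx : x ∈ Subgroup.closure s := hs ▸ Subgroup.mem_top x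
  induction hx using Subgroup.closure_induction with
  | mem x hx => exact h x hx
  | one => rw [map_one, ofMul_one]; exact H.zero_mem
  | mul x y _ _ hx hy => rw [map_mul, ofMul_mul]; exact H.add_mem hx hy
  | inv x _ hx => rw [map_inv, ofMul_inv]; exact H.neg_mem hx

/-- A finite `p`-group whose generators satisfy `x_i ∼ x_{σ(i)} ^ q` has an abelianization of order at
most `|W(q, σ)|`. -/
lemma card_abelianization_le {Q : Type*} [Group Q] [Finite Q] [TopologicalSpace Q]
    [DiscreteTopology Q] (hQ : IsPGroup p Q) {N g : ℕ} {q : ℤ_[p]ˣ} {σ : Equiv.Perm (Fin N)}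
    {r : Fin g → Fin N} (hr : IsCycleReps σ r) [Finite (WBraid q σ r)] {x : Fin N → Q}
    (hgen : Subgroup.closure (Set.range x) = ⊤)
    (hx : ∀ i, IsConj (x i) (padicPow (x (σ i)) (q : ℤ_[p]))) :
    Nat.card (Abelianization Q) ≤ Nat.card (WBraid q σ r) := by
  obtain ⟨n, hn⟩ := exists_pow_prime_pow_eq_one hQ
  have ha := nsmul_of_eq_zero hn
  obtain ⟨f, hf, -⟩ := exists_surjective_of_quotients
    (fun j => Additive.ofMul (Abelianization.of (x (r j)))) (fun j => ha _)
    (fun j => (q : ℤ_[p]) ^ cycleLen σ (r j) - 1) (fun j => by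
      rw [map_sub, padicSMul_of (hn _), padicSMul_of (hn _), padicPow_one hQ,
        ← of_eq_of_isConj (isConj_padicPow_cycleLen hQ hx (r j)), sub_self]) (by
      refine eq_top_of_forall_of_mem hgen ?_
      rintro _ ⟨i, rfl⟩
      obtain ⟨j, m, rfl⟩ := hr.exists_pow_eq i
      obtain ⟨k, hk⟩ := exists_padicPow_eq hQ (x (r j)) (((q ^ m)⁻¹ : ℤ_[p]ˣ) : ℤ_[p])
      rw [of_eq_of_isConj (isConj_padicPow_iterate_inv hQ hx m (r j)), hk, map_pow, ofMul_pow]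
      exact nsmul_mem (AddSubgroup.subset_closure (Set.mem_range_self j)) k)
  exact Nat.card_le_card_of_surjective (fun w => (f w).toMul) hf

variable {Γ : Type} [Group Γ] [TopologicalSpace Γ]

lemma classPowFixed_mk_iff [DiscreteTopology Γ] (hΓ : IsPGroup p Γ) (x : Γ) (z : ℤ_[p]) :
    ClassPowFixed (ConjClasses.mk x) z ↔ IsConj x (padicPow x z) := by
  simp only [ClassPowFixed, ConjClasses.mem_carrier_iff_mk_eq, ConjClasses.mk_eq_mk_iff_isConj]
  refine ⟨fun h => (h x (IsConj.refl x)).symm, fun h y hy => ?_⟩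
  exact (IsConj.padicPow hΓ hy z).trans h.symm

/-- The units `z` with `x ^ z ∼ x`. -/
def fixingSubgroup [DiscreteTopology Γ] (hΓ : IsPGroup p Γ) (x : Γ) : Subgroup ℤ_[p]ˣ where
  carrier := {z | IsConj x (padicPow x (z : ℤ_[p]))}
  one_mem' := by
    change IsConj x (padicPow x (1 : ℤ_[p]))
    rw [padicPow_one hΓ]
  mul_mem' {z w} hz hw := by
    have h := IsConj.padicPow hΓ hz (w : ℤ_[p])
    rw [padicPow_padicPow hΓ] at h
    exact IsConj.trans hw h
  inv_mem' {z} hz := by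
    have h := IsConj.padicPow hΓ hz ((z⁻¹ : ℤ_[p]ˣ) : ℤ_[p])
    rw [padicPow_padicPow hΓ, Units.mul_inv, padicPow_one hΓ] at h
    exact h.symm

lemma isClosed_fixingSubgroup [DiscreteTopology Γ] (hΓ : IsPGroup p Γ) (x : Γ) :
    IsClosed (fixingSubgroup hΓ x : Set ℤ_[p]ˣ) := by
  apply Subgroup.isClosed_of_isOpen
  apply Subgroup.isOpen_of_mem_nhds (g := 1)
  obtain ⟨n, hn⟩ := hΓ x
  have h : {z : ℤ_[p]ˣ | ‖(z : ℤ_[p]) - 1‖ < p ^ (-n : ℤ)} ∈ 𝓝 1 := by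
    refine IsOpen.mem_nhds (isOpen_lt ?_ continuous_const) ?_
    · exact (Units.continuous_val.sub continuous_const).norm
    · have : (0 : ℝ) < p ^ (-n : ℤ) := zpow_pos (by exact_mod_cast (Fact.out : p.Prime).pos) _
      simpa using this
  filter_upwards [h] with z hz
  have h1 := (PadicInt.norm_le_pow_iff_mem_span_pow _ n).1 (le_of_lt hz)
  change IsConj x (padicPow x (z : ℤ_[p]))
  rw [padicPow_eq_pow (m := 1) hn (by simpa using h1), pow_one]

lemma classPowFixed_of_mem_closure [DiscreteTopology Γ] (hΓ : IsPGroup p Γ) (c : ConjClasses Γ)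
    {u z : ℤ_[p]ˣ} (hu : ClassPowFixed c (u : ℤ_[p]))
    (hz : z ∈ (Subgroup.zpowers u).topologicalClosure) : ClassPowFixed c (z : ℤ_[p]) := by
  obtain ⟨x, rfl⟩ := ConjClasses.mk_surjective c
  rw [classPowFixed_mk_iff hΓ] at hu ⊢
  exact Subgroup.topologicalClosure_minimal _ ((Subgroup.zpowers_le (H := fixingSubgroup hΓ x)).2 hu)
    (isClosed_fixingSubgroup hΓ x) hz

/-- The ideals defining `W(Z)` and `W(q, σ)` agree, because the ideals of `ℤ_p` are closed. -/
lemma span_braidType_eq {N g : ℕ} (q : ℤ_[p]ˣ) (σ : Equiv.Perm (Fin N)) (r : Fin g → Fin N)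
    (j : Fin g) : Ideal.span {x : ℤ_[p] | ∃ z ∈ braidType q σ r j, x = (z : ℤ_[p]) - 1} =
      Ideal.span {(q : ℤ_[p]) ^ cycleLen σ (r j) - 1} := by
  set u : ℤ_[p]ˣ := q ^ cycleLen σ (r j) with hu
  have huq : (q : ℤ_[p]) ^ cycleLen σ (r j) = (u : ℤ_[p]) := by simp [u]
  rw [huq]
  refine le_antisymm (Ideal.span_le.2 ?_) (Ideal.span_mono ?_)
  · rintro _ ⟨z, hz, rfl⟩
    let I : Ideal ℤ_[p] := Ideal.span {(u : ℤ_[p]) - 1}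
    have hI : IsClosed (I : Set ℤ_[p]) := by
      have : (I : Set ℤ_[p]) = Set.range fun y => y * ((u : ℤ_[p]) - 1) := by
        ext y
        exact Ideal.mem_span_singleton'
      rw [this]
      exact (isCompact_range (by fun_prop)).isClosed
    let S : Subgroup ℤ_[p]ˣ := (Units.map (Ideal.Quotient.mk I : ℤ_[p] →* ℤ_[p] ⧸ I)).ker
    have hS (w : ℤ_[p]ˣ) : w ∈ S ↔ (w : ℤ_[p]) - 1 ∈ I := by
      rw [← Ideal.Quotient.mk_eq_mk_iff_sub_mem, map_one]
      exact Units.ext_iff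
    have hSc : IsClosed (S : Set ℤ_[p]ˣ) := by
      have : (S : Set ℤ_[p]ˣ) = (fun w : ℤ_[p]ˣ => (w : ℤ_[p]) - 1) ⁻¹' I := Set.ext hS
      rw [this]
      exact hI.preimage (Units.continuous_val.sub continuous_const)
    refine (hS z).1 (Subgroup.topologicalClosure_minimal _ (Subgroup.zpowers_le.2 ?_) hSc hz)
    exact (hS u).2 (Ideal.mem_span_singleton_self _)
  · rintro _ rfl
    exact ⟨u, Subgroup.le_topologicalClosure _ (Subgroup.mem_zpowers u), rfl⟩

lemma eq_one_of_sq_eq_one {G : Type*} [Group G] (hp : p ≠ 2) (hG : IsPGroup p G) {x : G}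
    (hx : x ^ 2 = 1) : x = 1 := by
  obtain ⟨n, hn⟩ := IsPGroup.iff_orderOf.1 hG x
  have h1 := orderOf_dvd_of_pow_eq_one hx
  have h2 : Nat.Coprime (orderOf x) 2 := by
    rw [hn]
    exact Nat.Coprime.pow_left _ ((Nat.coprime_primes Fact.out Nat.prime_two).2 hp)
  exact orderOf_eq_one_iff.1 (h2.eq_one_of_dvd h1)

instance closure_carrier_normal {g : ℕ} (c : Fin g → ConjClasses Γ) :
    (Subgroup.closure (⋃ j, (c j).carrier)).Normal := by
  have h : Group.conjugatesOfSet (⋃ j, (c j).carrier) = ⋃ j, (c j).carrier := by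
    refine Set.Subset.antisymm (fun y hy => ?_) Group.subset_conjugatesOfSet
    obtain ⟨x, hx, hxy⟩ := Group.mem_conjugatesOfSet_iff.1 hy
    obtain ⟨j, hj⟩ := Set.mem_iUnion.1 hx
    refine Set.mem_iUnion.2 ⟨j, ?_⟩
    rw [ConjClasses.mem_carrier_iff_mk_eq] at hj ⊢
    rw [← hj, ConjClasses.mk_eq_mk_iff_isConj]
    exact hxy.symm
  have := Subgroup.normalClosure_normal (s := ⋃ j, (c j).carrier)
  rwa [Subgroup.normalClosure, h] at this

/-- If `Γ^ab ≅ W(q, σ)`, the pairs counted by `A_Z(Γ)` are the pairs `(c, 1)`, where `c` is a generating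
tuple of conjugacy classes with `c_j ^ (q ^ k_j) = c_j`. -/
theorem isLocalData_braidType_iff [DiscreteTopology Γ] [Finite Γ] (hp : p ≠ 2) (hΓ : IsPGroup p Γ)
    {N g : ℕ} {q : ℤ_[p]ˣ} {σ : Equiv.Perm (Fin N)} {r : Fin g → Fin N}
    (hab : Nonempty (Additive (Abelianization Γ) ≃+ WBraid q σ r))
    (c : Fin g → ConjClasses Γ) (ι : Γ) :
    IsLocalData (braidType q σ r) c ι ↔ (Subgroup.closure (⋃ j, (c j).carrier) = ⊤ ∧
      ∀ j, ClassPowFixed (c j) ((q : ℤ_[p]) ^ cycleLen σ (r j))) ∧ ι = 1 := by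
  constructor
  · intro h
    refine ⟨⟨eq_top_of_map_abelianization hΓ _ ?_, fun j => ?_⟩, eq_one_of_sq_eq_one hp hΓ h.inv_sq⟩
    · rw [MonoidHom.map_closure, Set.image_iUnion, h.generates]
    · have := h.pow_fixed j (q ^ cycleLen σ (r j))
        (Subgroup.le_topologicalClosure _ (Subgroup.mem_zpowers _))
      rwa [Units.val_pow_eq_pow_val] at this
  · rintro ⟨⟨hgen, hfix⟩, rfl⟩
    have hfix' (j : Fin g) :
        ClassPowFixed (c j) ((q ^ cycleLen σ (r j) : ℤ_[p]ˣ) : ℤ_[p]) := by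
      rw [Units.val_pow_eq_pow_val]
      exact hfix j
    refine ⟨one_pow 2, fun j z hz => classPowFixed_of_mem_closure hΓ _ (hfix' j) hz, ?_, ?_,
      fun h => absurd h hp⟩
    · rw [← Set.image_iUnion, ← MonoidHom.map_closure, hgen, ← MonoidHom.range_eq_map,
        MonoidHom.range_eq_top]
      exact QuotientGroup.mk_surjective
    obtain ⟨n, hn⟩ := exists_pow_prime_pow_eq_one hΓ
    have ha := nsmul_of_eq_zero hn
    choose x hx using fun j => ConjClasses.mk_surjective (c j)
    have hxc (j : Fin g) (y : Γ) (hy : y ∈ (c j).carrier) : IsConj (x j) y := by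
      rw [← hx, ConjClasses.mem_carrier_iff_mk_eq, ConjClasses.mk_eq_mk_iff_isConj] at hy
      exact hy.symm
    obtain ⟨f, hf, hfw⟩ := exists_surjective_of_quotients
      (fun j => Additive.ofMul (Abelianization.of (x j))) (fun j => ha _)
      (fun j => (q : ℤ_[p]) ^ cycleLen σ (r j) - 1) (fun j => by
        have h1 := hfix j
        rw [← hx, classPowFixed_mk_iff hΓ] at h1
        rw [map_sub, padicSMul_of (hn _), padicSMul_of (hn _), padicPow_one hΓ,
          ← of_eq_of_isConj h1, sub_self]) (by
        refine eq_top_of_forall_of_mem hgen fun y hy => ?_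
        obtain ⟨j, hj⟩ := Set.mem_iUnion.1 hy
        rw [← of_eq_of_isConj (hxc j y hj)]
        exact AddSubgroup.subset_closure (Set.mem_range_self j))
    obtain ⟨e⟩ := hab
    have hfin : Finite (WBraid q σ r) := Finite.of_equiv _ e.toEquiv
    have hbij : Function.Bijective f :=
      hf.bijective_of_nat_card_le (Nat.card_congr e.toEquiv).ge
    refine ⟨(AddEquiv.piCongrRight fun j =>
      (Ideal.quotEquivOfEq (span_braidType_eq q σ r j)).toAddEquiv).trans
        (AddEquiv.ofBijective f hbij), fun w y hy => ?_⟩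
    refine (hfw w).trans ?_
    rw [ofMul_prod]
    refine Finset.sum_congr rfl fun j _ => ?_
    rw [padicSMul_of (hn _), of_eq_of_isConj (IsConj.padicPow hΓ (hxc j _ (hy j)) (w j))]

/-- If `Γ^ab ≅ W(q, σ)`, then `A_Z(Γ)` is the number of generating tuples of conjugacy classes with
`c_j ^ (q ^ k_j) = c_j`. -/
theorem countA_braidType_eq [DiscreteTopology Γ] [Finite Γ] (hp : p ≠ 2) (hΓ : IsPGroup p Γ)
    {N g : ℕ} {q : ℤ_[p]ˣ} {σ : Equiv.Perm (Fin N)} {r : Fin g → Fin N}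
    (hab : Nonempty (Additive (Abelianization Γ) ≃+ WBraid q σ r)) :
    countA (braidType q σ r) Γ =
      Nat.card {c : Fin g → ConjClasses Γ // Subgroup.closure (⋃ j, (c j).carrier) = ⊤ ∧
        ∀ j, ClassPowFixed (c j) ((q : ℤ_[p]) ^ cycleLen σ (r j))} := by
  have h := isLocalData_braidType_iff hp hΓ hab
  refine Nat.card_congr ⟨fun d => ⟨d.1.1, ((h _ _).1 d.2).1⟩, fun c => ⟨(c.1, 1), (h _ _).2 ⟨c.2, rfl⟩⟩,
    fun d => ?_, fun c => rfl⟩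
  exact Subtype.ext (Prod.ext rfl ((h _ _).1 d.2).2.symm)

end LocalData

/-! ### Homomorphisms from pro-`p` completions -/

section Completion

variable {p : ℕ} {D : Type*} [Group D]

/-- The projection of the pro-`p` completion of `D` to the finite quotient `D ⧸ K`. -/
def completionProj (K : PIndex p D) : ProPCompletion p D →ₜ* PQuot K where
  toMonoidHom := (Pi.evalMonoidHom _ K).comp (ProPCompletion p D).subtype
  continuous_toFun := (continuous_apply K).comp continuous_subtype_val

lemma completionProj_toCompletion (K : PIndex p D) (d : D) :
    completionProj K (toCompletion p D d) = PQuot.proj K d := rfl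

lemma proj_surjective (K : PIndex p D) : Function.Surjective (PQuot.proj K) :=
  QuotientGroup.mk_surjective

lemma completion_ext {x y : ProPCompletion p D}
    (h : ∀ K, completionProj K x = completionProj K y) : x = y :=
  Subtype.ext (funext h)

lemma completionProj_surjective (K : PIndex p D) : Function.Surjective (completionProj K) := by
  intro y
  obtain ⟨d, rfl⟩ := proj_surjective K y
  exact ⟨_, completionProj_toCompletion K d⟩

lemma completion_hom_ext {H : Type*} [Group H] [TopologicalSpace H] [T2Space H]
    {φ ψ : ProPCompletion p D →ₜ* H} (h : ∀ d, φ (toCompletion p D d) = ψ (toCompletion p D d)) :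
    φ = ψ :=
  ContinuousMonoidHom.ext fun x => congrFun (toCompletion_denseRange.equalizer
    φ.continuous_toFun ψ.continuous_toFun (funext h)) x

lemma completionProj_eq_of_le {K M : PIndex p D} (hMK : M.1 ≤ K.1) {x y : ProPCompletion p D}
    (h : completionProj M x = completionProj M y) : completionProj K x = completionProj K y := by
  let χ : PQuot M →* PQuot K :=
    letI := M.2.1
    QuotientGroup.lift M.1 (PQuot.proj K) fun d hd =>
      letI := K.2.1
      (QuotientGroup.eq_one_iff d).2 (hMK hd)
  have h1 : completionProj K = (⟨χ, continuous_of_discreteTopology⟩ : PQuot M →ₜ* PQuot K).comp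
      (completionProj M) := completion_hom_ext fun d => rfl
  rw [h1]
  exact congrArg χ h

variable [Fact p.Prime]

/-- Homomorphisms to finite `p`-groups extend to the pro-`p` completion. -/
lemma exists_completion_lift {Q : Type*} [Group Q] [Finite Q] [TopologicalSpace Q]
    [DiscreteTopology Q] (hQ : IsPGroup p Q) (ψ : D →* Q) :
    ∃ φ : ProPCompletion p D →ₜ* Q, ∀ d, φ (toCompletion p D d) = ψ d := by
  let L := kerIndex hQ ψ
  let χ : PQuot L →* Q := QuotientGroup.lift ψ.ker ψ fun _ h => h
  exact ⟨(⟨χ, continuous_of_discreteTopology⟩ : PQuot L →ₜ* Q).comp (completionProj L),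
    fun d => rfl⟩

lemma exists_le_le (K L : PIndex p D) : ∃ M : PIndex p D, M.1 ≤ K.1 ∧ M.1 ≤ L.1 := by
  obtain ⟨⟨K, hK, a, ha⟩, ⟨L, hL, b, hb⟩⟩ := K, L
  have hp0 : p ≠ 0 := (Fact.out : p.Prime).ne_zero
  have hKf : K.FiniteIndex := ⟨by rw [ha]; exact pow_ne_zero _ hp0⟩
  have hLf : L.FiniteIndex := ⟨by rw [hb]; exact pow_ne_zero _ hp0⟩
  refine ⟨⟨K ⊓ L, inferInstance, IsPGroup.iff_card.1 fun x => ⟨a + b, ?_⟩⟩,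
    inf_le_left, inf_le_right⟩
  obtain ⟨d, rfl⟩ := QuotientGroup.mk_surjective x
  have h1 (H : Subgroup D) [H.Normal] {n : ℕ} (hn : H.index = n) : d ^ n ∈ H := by
    rw [← QuotientGroup.eq_one_iff, QuotientGroup.mk_pow, ← hn, Subgroup.index, pow_card_eq_one']
  rw [← QuotientGroup.mk_pow, QuotientGroup.eq_one_iff]
  refine ⟨?_, ?_⟩
  · rw [pow_add, pow_mul]
    exact pow_mem (h1 K ha) _
  · rw [pow_add, mul_comm, pow_mul]
    exact pow_mem (h1 L hb) _

/-- Compactness: a system of closed conditions that is solvable at each finite level, and whose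
conditions at finer levels are stronger, is solvable. -/
lemma nonempty_iInter_of_forall {X : Type*} [TopologicalSpace X] [CompactSpace X]
    (T : PIndex p D → Set X) (hT : ∀ K, IsClosed (T K)) (hne : ∀ K, (T K).Nonempty)
    (hmono : ∀ K M, M.1 ≤ K.1 → T M ⊆ T K) : (⋂ K, T K).Nonempty := by
  have : Nonempty (PIndex p D) := ⟨⟨⊤, inferInstance, 0, by simp⟩⟩
  refine IsCompact.nonempty_iInter_of_directed_nonempty_isCompact_isClosed T (fun K L => ?_) hne
    (fun K => (hT K).isCompact) hT
  obtain ⟨M, hK, hL⟩ := exists_le_le K L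
  exact ⟨M, hmono K M hK, hmono L M hL⟩

/-- Closed subgroups of the pro-`p` completion are detected by the finite quotients. -/
lemma exists_completionProj_ne {R : Subgroup (ProPCompletion p D)}
    (hR : IsClosed (R : Set (ProPCompletion p D))) {x : ProPCompletion p D} (hx : x ∉ R) :
    ∃ K, ∀ y ∈ R, completionProj K y ≠ completionProj K x := by
  by_contra! h
  obtain ⟨y, hy⟩ := nonempty_iInter_of_forall
    (fun K : PIndex p D => (R : Set (ProPCompletion p D)) ∩ {y | completionProj K y = completionProj K x})
    (fun K => hR.inter (isClosed_eq (completionProj K).continuous_toFun continuous_const)) h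
    (fun K M hMK y hy => ⟨hy.1, completionProj_eq_of_le hMK hy.2⟩)
  rw [Set.mem_iInter] at hy
  have hyx : y = x := completion_ext fun K => (hy K).2
  exact hx (hyx ▸ (hy ⟨⊤, inferInstance, 0, by simp⟩).1)

/-- Homomorphisms to a pro-`p` completion extend to the pro-`p` completion of the source. -/
lemma exists_completion_hom {D' : Type*} [Group D'] (ψ : D →* ProPCompletion p D') :
    ∃ φ : ProPCompletion p D →ₜ* ProPCompletion p D', ∀ d, φ (toCompletion p D d) = ψ d := by
  choose φ hφ using fun K : PIndex p D' => exists_completion_lift (isPGroup_pQuot K)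
    ((completionProj K : ProPCompletion p D' →* PQuot K).comp ψ)
  let Φ : ProPCompletion p D →* ∀ K : PIndex p D', PQuot K :=
    MonoidHom.pi fun K => (φ K : ProPCompletion p D →* PQuot K)
  have hΦ : Continuous Φ := continuous_pi fun K => (φ K).continuous_toFun
  have hd (d : D) : Φ (toCompletion p D d) = (ψ d).1 := funext fun K => hφ K d
  have hmem (x : ProPCompletion p D) : Φ x ∈ ProPCompletion p D' := by
    refine toCompletion_denseRange.induction_on x
      ((Subgroup.isClosed_topologicalClosure _).preimage hΦ) fun d => ?_
    rw [hd]
    exact (ψ d).2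
  exact ⟨⟨Φ.codRestrict _ hmem, hΦ.subtype_mk hmem⟩, fun d => Subtype.ext (hd d)⟩

/-- The limit defining `ℤ_p`-powers exists in a pro-`p` completion. -/
lemma tendsto_padicPow (x : ProPCompletion p D) (z : ℤ_[p]) :
    Tendsto (fun n => x ^ z.appr n) atTop (𝓝 (padicPow x z)) := by
  have h (K : PIndex p D) : ∀ᶠ n in atTop,
      padicPow (completionProj K x) z = completionProj K (x ^ z.appr n) := by
    obtain ⟨n, hn⟩ := isPGroup_pQuot K (completionProj K x)
    filter_upwards [eventually_ge_atTop n] with m hm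
    rw [padicPow_eq_pow hn (sub_appr_mem z hm), map_pow]
  have h1 : Tendsto (fun n => (x ^ z.appr n).1) atTop
      (𝓝 fun K => padicPow (completionProj K x) z) :=
    tendsto_pi_nhds.2 fun K => tendsto_const_nhds.congr' (h K)
  have hmem : (fun K => padicPow (completionProj K x) z) ∈ ProPCompletion p D :=
    (Subgroup.isClosed_topologicalClosure _).mem_of_tendsto h1
      (Eventually.of_forall fun n => (x ^ z.appr n).2)
  have h2 : Tendsto (fun n => x ^ z.appr n) atTop (𝓝 ⟨_, hmem⟩) := tendsto_subtype_rng.2 h1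
  rw [padicPow, h2.limUnder_eq]
  exact h2

lemma map_padicPow {H : Type*} [Group H] [TopologicalSpace H] [T2Space H]
    (φ : ProPCompletion p D →ₜ* H) (x : ProPCompletion p D) (z : ℤ_[p]) :
    φ (padicPow x z) = padicPow (φ x) z := by
  have h := (φ.continuous_toFun.tendsto _).comp (tendsto_padicPow x z)
  refine Eq.symm (Tendsto.limUnder_eq (h.congr fun n => ?_))
  exact map_pow φ x _

end Completion

/-! ### The set `B_N(q, σ)` is non-empty -/

section Sphere

variable {p : ℕ} {N : ℕ}

lemma sphere_hom_ext {H : Type*} [Group H] [TopologicalSpace H] [T2Space H]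
    {φ ψ : F p N →ₜ* H} (h : ∀ i, φ (gen p i) = ψ (gen p i)) : φ = ψ := by
  refine completion_hom_ext fun d => ?_
  have h1 : (φ : F p N →* H).comp (toCompletion p _) = (ψ : F p N →* H).comp (toCompletion p _) :=
    PresentedGroup.ext h
  exact DFunLike.congr_fun h1 d

lemma prod_gen_eq_one : (List.ofFn fun i : Fin N => gen p i).prod = 1 := by
  have h1 : (List.ofFn fun i : Fin N => (PresentedGroup.of i : SphereGroup N)).prod = 1 := by
    have := PresentedGroup.one_of_mem
      (rels := {(List.ofFn fun i : Fin N => FreeGroup.of i).prod}) rfl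
    rw [map_list_prod, List.map_ofFn] at this
    exact this
  have h2 := congrArg (toCompletion p (SphereGroup N)) h1
  rw [map_list_prod, List.map_ofFn, map_one] at h2
  exact h2

lemma closure_range_map_gen {Q : Type*} [Group Q] [TopologicalSpace Q] [DiscreteTopology Q]
    (φ : F p N →ₜ* Q) (hφ : Function.Surjective φ) :
    Subgroup.closure (Set.range fun i => φ (gen p i)) = ⊤ := by
  let f : SphereGroup N →* Q := (φ : F p N →* Q).comp (toCompletion p _)
  have hf : Function.Surjective f := by
    rw [← Set.range_eq_univ, ← dense_discrete]
    exact hφ.denseRange.comp toCompletion_denseRange φ.continuous_toFun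
  have h := congrArg (Subgroup.map f) (PresentedGroup.closure_range_of
    {(List.ofFn fun i : Fin N => FreeGroup.of i).prod})
  rwa [MonoidHom.map_closure, ← MonoidHom.range_eq_map, MonoidHom.range_eq_top.2 hf,
    ← Set.range_comp] at h

variable [Fact p.Prime]

/-- Tuples in `F` with product `1` define continuous endomorphisms of `F`. -/
lemma exists_sphere_end (y : Fin N → F p N) (hy : (List.ofFn y).prod = 1) :
    ∃ φ : F p N →ₜ* F p N, ∀ i, φ (gen p i) = y i := by
  obtain ⟨φ, hφ⟩ := exists_completion_hom (p := p)
    (PresentedGroup.toGroup (f := y) (rels := {(List.ofFn fun i : Fin N => FreeGroup.of i).prod})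
      (by
        rintro _ rfl
        rw [map_list_prod, List.map_ofFn]
        simpa [Function.comp_def] using hy))
  exact ⟨φ, fun i => (hφ _).trans (PresentedGroup.toGroup.of _)⟩

lemma coprime_appr (q : ℤ_[p]ˣ) (n : ℕ) : ((q : ℤ_[p]).appr (n + 1)).Coprime p := by
  rw [Nat.coprime_comm, Nat.Prime.coprime_iff_not_dvd Fact.out]
  intro h
  have h1 : (p : ℤ_[p]) ∣ (q : ℤ_[p]) - ((q : ℤ_[p]).appr (n + 1) : ℤ_[p]) :=
    (dvd_pow_self _ n.succ_ne_zero).trans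
      (Ideal.mem_span_singleton.1 (sub_appr_mem (q : ℤ_[p]) (le_refl (n + 1))))
  have h2 : (p : ℤ_[p]) ∣ q := by
    have := dvd_add h1 (Nat.cast_dvd_cast (α := ℤ_[p]) h)
    rwa [sub_add_cancel] at this
  exact PadicInt.prime_p.not_isUnit (isUnit_of_dvd_unit h2 q.isUnit)

/-- By compactness, the conjugates `y_i` of `x_{σ(i)} ^ q` can be chosen in `F` with product `1`. -/
lemma exists_conj_padicPow_prod_eq_one (q : ℤ_[p]ˣ) (σ : Equiv.Perm (Fin N)) :
    ∃ y : Fin N → F p N, (∀ i, IsConj (y i) (padicPow (gen p (σ i)) (q : ℤ_[p]))) ∧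
      (List.ofFn y).prod = 1 := by
  let T (K : PIndex p (SphereGroup N)) : Set (Fin N → F p N) :=
    {y | ∀ i, IsConj (y i) (padicPow (gen p (σ i)) (q : ℤ_[p]))} ∩
      {y | completionProj K (List.ofFn y).prod = completionProj K 1}
  suffices h : (⋂ K, T K).Nonempty by
    obtain ⟨y, hy⟩ := h
    rw [Set.mem_iInter] at hy
    exact ⟨y, (hy ⟨⊤, inferInstance, 0, by simp⟩).1, completion_ext fun K => (hy K).2⟩
  refine nonempty_iInter_of_forall T ?_ ?_ ?_
  · intro K
    refine IsClosed.inter ?_ (isClosed_eq ?_ continuous_const)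
    · rw [Set.ofPred_forall]
      exact isClosed_iInter fun i => (isClosed_conj _).preimage (continuous_apply i)
    · refine (completionProj K).continuous_toFun.comp ?_
      simp_rw [List.ofFn_eq_map]
      exact continuous_list_prod _ fun i _ => continuous_apply i
  · intro K
    obtain ⟨n, hn⟩ := exists_pow_prime_pow_eq_one (isPGroup_pQuot K)
    obtain ⟨a, ha⟩ := IsPGroup.iff_card.1 (isPGroup_pQuot K)
    have hm : ((q : ℤ_[p]).appr (n + 1)).Coprime (Nat.card (PQuot K)) := by
      rw [ha]
      exact (coprime_appr q n).pow_right a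
    obtain ⟨y, hy, hprod⟩ := exists_conj_pow_prod_eq_one (fun i => completionProj K (gen p i))
      (by
        have := congrArg (completionProj K) (prod_gen_eq_one (p := p) (N := N))
        rwa [map_list_prod, List.map_ofFn, map_one] at this) σ _ hm
    choose c hc using fun i => isConj_iff.1 (hy i)
    choose c' hc' using fun i => completionProj_surjective K (c i)
    refine ⟨fun i => c' i * padicPow (gen p (σ i)) (q : ℤ_[p]) * (c' i)⁻¹, fun i => ?_, ?_⟩
    · exact (isConj_iff.2 ⟨c' i, rfl⟩).symm
    · change completionProj K _ = _
      rw [map_list_prod, List.map_ofFn, map_one, ← hprod]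
      congr 2
      funext i
      rw [Function.comp_apply, map_mul, map_mul, map_inv, hc', map_padicPow,
        padicPow_eq_pow (n := n + 1) (by rw [pow_succ, pow_mul, hn, one_pow])
          (sub_appr_mem _ le_rfl)]
      exact hc i
  · intro K M hMK y hy
    exact ⟨hy.1, completionProj_eq_of_le hMK hy.2⟩

end Sphere

section Braid

variable {p : ℕ} [Fact p.Prime] {N : ℕ}

/-- If the `x_i` generate a finite `p`-group, so do conjugates of the elements `x_{σ(i)} ^ q`: a maximal
subgroup is normal. -/
lemma eq_top_of_isConj_padicPow {G : Type*} [Group G] [Finite G] [TopologicalSpace G]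
    [DiscreteTopology G] (hG : IsPGroup p G) {x y : Fin N → G}
    (hx : Subgroup.closure (Set.range x) = ⊤) {q : ℤ_[p]ˣ} {σ : Equiv.Perm (Fin N)}
    (hxy : ∀ i, IsConj (y i) (padicPow (x (σ i)) (q : ℤ_[p]))) {H : Subgroup G}
    (hy : ∀ i, y i ∈ H) : H = ⊤ := by
  obtain h | ⟨M, hM, hHM⟩ := eq_top_or_exists_le_coatom H
  · exact h
  have hnil := hG.isNilpotent
  have hn : M.Normal := Subgroup.NormalizerCondition.normal_of_coatom M
    Group.normalizerCondition_of_isNilpotent hM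
  refine absurd ?_ hM.1
  rw [eq_top_iff, ← hx, Subgroup.closure_le]
  rintro _ ⟨i, rfl⟩
  obtain ⟨c, hc⟩ := isConj_iff.1 (hxy (σ.symm i))
  rw [Equiv.apply_symm_apply] at hc
  have h1 : padicPow (x i) (q : ℤ_[p]) ∈ M := hc ▸ hn.conj_mem _ (hHM (hy _)) c
  obtain ⟨m, hm⟩ := exists_padicPow_eq hG (padicPow (x i) (q : ℤ_[p])) ((q⁻¹ : ℤ_[p]ˣ) : ℤ_[p])
  rw [padicPow_padicPow hG, Units.mul_inv, padicPow_one hG] at hm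
  rw [hm]
  exact pow_mem h1 m

instance finite_sphereHom {Q : Type*} [Group Q] [Finite Q] [TopologicalSpace Q]
    [DiscreteTopology Q] : Finite (F p N →ₜ* Q) :=
  Finite.of_injective (fun φ i => φ (gen p i)) fun _ _ h => sphere_hom_ext fun i => congrFun h i

/-- A continuous surjective endomorphism of `F` is injective, because it permutes the finite set of
homomorphisms to each finite quotient. -/
lemma sphere_end_injective {φ : F p N →ₜ* F p N} (hφ : Function.Surjective φ) :
    Function.Injective φ := by
  refine (injective_iff_map_eq_one φ).2 fun x hx => completion_ext fun K => ?_
  have hinj : Function.Injective fun ψ : F p N →ₜ* PQuot K => ψ.comp φ := fun ψ ψ' h =>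
    ContinuousMonoidHom.ext fun y => by
      obtain ⟨z, rfl⟩ := hφ y
      exact DFunLike.congr_fun h z
  obtain ⟨ψ, hψ⟩ := (Finite.injective_iff_surjective.1 hinj) (completionProj K)
  rw [← hψ, map_one]
  exact (congrArg ψ hx).trans (map_one ψ)

/-- An endomorphism that maps the `x_i` to conjugates of the `x_{σ(i)} ^ q` is surjective. -/
lemma sphere_end_surjective {φ : F p N →ₜ* F p N} {q : ℤ_[p]ˣ} {σ : Equiv.Perm (Fin N)}
    (hφ : ∀ i, IsConj (φ (gen p i)) (padicPow (gen p (σ i)) (q : ℤ_[p]))) :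
    Function.Surjective φ := by
  intro x
  by_contra hx
  have hcl : IsClosed ((φ : F p N →* F p N).range : Set (F p N)) := by
    rw [MonoidHom.coe_range]
    exact (isCompact_range φ.continuous_toFun).isClosed
  obtain ⟨K, hK⟩ := exists_completionProj_ne hcl (x := x) hx
  have htop : (φ : F p N →* F p N).range.map (completionProj K : F p N →* PQuot K) = ⊤ := by
    refine eq_top_of_isConj_padicPow (isPGroup_pQuot K)
      (closure_range_map_gen (completionProj K) (completionProj_surjective K)) (q := q) (σ := σ)
      (fun i => ?_) fun i => Subgroup.mem_map_of_mem _ ⟨gen p i, rfl⟩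
    have h := MonoidHom.map_isConj (completionProj K : F p N →* PQuot K) (hφ i)
    change IsConj _ (completionProj K _) at h
    rwa [map_padicPow] at h
  obtain ⟨y, hy, hyx⟩ : completionProj K x ∈
      (φ : F p N →* F p N).range.map (completionProj K : F p N →* PQuot K) :=
    htop ▸ Subgroup.mem_top _
  exact hK y hy hyx

theorem braidCoset_nonempty (q : ℤ_[p]ˣ) (σ : Equiv.Perm (Fin N)) : (braidCoset q σ).Nonempty := by
  obtain ⟨y, hy, hprod⟩ := exists_conj_padicPow_prod_eq_one q σ
  obtain ⟨φ, hφ⟩ := exists_sphere_end y hprod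
  have hc : ∀ i, IsConj (φ (gen p i)) (padicPow (gen p (σ i)) (q : ℤ_[p])) := fun i => by
    rw [hφ]
    exact hy i
  have hs := sphere_end_surjective hc
  let e : F p N ≃* F p N := MulEquiv.ofBijective (φ : F p N →* F p N) ⟨sphere_end_injective hs, hs⟩
  have he : Continuous e := φ.continuous_toFun
  exact ⟨⟨e, he, (he.homeoOfEquivCompactToT2 (f := e.toEquiv)).continuous_symm⟩, hc⟩

end Braid

/-! ### Homomorphisms from `F` to `Γ` that are fixed by `α` -/

section FixedEpi

variable {p N : ℕ}

lemma relSubgroup_le_ker {Γ : Type*} [Group Γ] [TopologicalSpace Γ] [T1Space Γ]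
    {α : F p N ≃ₜ* F p N} {φ : F p N →ₜ* Γ} (hα : ∀ i, φ (α (gen p i)) = φ (gen p i)) :
    relSubgroup α ≤ (φ : F p N →* Γ).ker := by
  refine Subgroup.topologicalClosure_minimal _ (Subgroup.normalClosure_le_normal ?_)
    (isClosed_singleton.preimage φ.continuous_toFun)
  rintro _ ⟨i, rfl⟩
  change φ _ = 1
  rw [map_mul, hα, map_inv, mul_inv_cancel]

/-- The surjections `F → Γ` fixed by `α`. -/
def fixedEpi (Γ : Type*) [Group Γ] [TopologicalSpace Γ] (α : F p N ≃ₜ* F p N) :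
    Set (F p N →ₜ* Γ) :=
  {φ | Function.Surjective φ ∧ ∀ i, φ (α (gen p i)) = φ (gen p i)}

/-- An abstract isomorphism suffices: a closed subgroup of finite index is open, so the resulting
homomorphism on `F` is continuous. -/
lemma fixedEpi_nonempty_of_equiv {Γ : Type*} [Group Γ] [Finite Γ] [TopologicalSpace Γ]
    [DiscreteTopology Γ] {α : F p N ≃ₜ* F p N} (e : BraidGroupQuot α ≃* Γ) :
    (fixedEpi Γ α).Nonempty := by
  have hfin : Finite (F p N ⧸ relSubgroup α) := Finite.of_equiv _ e.symm.toEquiv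
  have hfi : (relSubgroup α).FiniteIndex := Subgroup.finiteIndex_of_finite_quotient
  have hopen : IsOpen (relSubgroup α : Set (F p N)) :=
    Subgroup.isOpen_of_isClosed_of_finiteIndex _ (Subgroup.isClosed_topologicalClosure _)
  have hdisc : DiscreteTopology (F p N ⧸ relSubgroup α) := QuotientGroup.discreteTopology hopen
  refine ⟨⟨e.toMonoidHom.comp (QuotientGroup.mk' _),
    (continuous_of_discreteTopology (f := e)).comp continuous_quot_mk⟩,
    e.surjective.comp (QuotientGroup.mk'_surjective _), fun i => ?_⟩
  refine congrArg e (QuotientGroup.eq_iff_div_mem.2 ?_)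
  rw [div_eq_mul_inv]
  exact Subgroup.le_topologicalClosure _ (Subgroup.subset_normalClosure ⟨i, rfl⟩)

lemma exists_equiv_comp_eq {Γ : Type*} [Group Γ] [TopologicalSpace Γ] {φ ψ : F p N →ₜ* Γ}
    (hφ : Function.Surjective φ) (hψ : Function.Surjective ψ)
    (h : (φ : F p N →* Γ).ker = (ψ : F p N →* Γ).ker) : ∃ θ : Γ ≃* Γ, ∀ x, θ (φ x) = ψ x := by
  let e₁ := QuotientGroup.quotientKerEquivOfSurjective (φ : F p N →* Γ) hφ
  let e₂ := QuotientGroup.quotientKerEquivOfSurjective (ψ : F p N →* Γ) hψ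
  refine ⟨(e₁.symm.trans (QuotientGroup.quotientMulEquivOfEq h)).trans e₂, fun x => ?_⟩
  have h1 : e₁.symm (φ x) = QuotientGroup.mk x := by
    rw [MulEquiv.symm_apply_eq]
    rfl
  change e₂ (QuotientGroup.quotientMulEquivOfEq h (e₁.symm (φ x))) = ψ x
  rw [h1]
  rfl

variable [Fact p.Prime]

lemma exists_completionProj_factor {D Q : Type*} [Group D] [Group Q] [Finite Q]
    [TopologicalSpace Q] [DiscreteTopology Q] (hQ : IsPGroup p Q) (φ : ProPCompletion p D →ₜ* Q) :
    ∃ K, ∀ x, completionProj K x = 1 → φ x = 1 := by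
  let ψ : D →* Q := (φ : ProPCompletion p D →* Q).comp (toCompletion p D)
  let χ : PQuot (kerIndex hQ ψ) →* Q := QuotientGroup.lift ψ.ker ψ fun _ h => h
  refine ⟨kerIndex hQ ψ, fun x hx => ?_⟩
  have h : φ = (⟨χ, continuous_of_discreteTopology⟩ : PQuot (kerIndex hQ ψ) →ₜ* Q).comp
    (completionProj _) := completion_hom_ext fun d => rfl
  rw [h]
  change χ (completionProj _ x) = 1
  rw [hx, map_one]

/-- A surjection from `F` to a balanced group `Γ` that is fixed by `α ∈ B_N(q, σ)` identifies `Γ` with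
the quotient of `F` by the relations `α(x_i) = x_i`. -/
theorem ker_eq_relSubgroup {q : ℤ_[p]ˣ} {g : ℕ} {σ : Equiv.Perm (Fin N)} {r : Fin g → Fin N}
    (hr : IsCycleReps σ r) {Γ : Type} [Group Γ] [Finite Γ] [TopologicalSpace Γ]
    [DiscreteTopology Γ] (hΓ : IsPGroup p Γ) (hbal : IsBalanced p Γ)
    (hab : Nonempty (Additive (Abelianization Γ) ≃+ WBraid q σ r))
    {α : F p N ≃ₜ* F p N} (hαB : α ∈ braidCoset q σ) {φ : F p N →ₜ* Γ}
    (hφ : Function.Surjective φ) (hα : ∀ i, φ (α (gen p i)) = φ (gen p i)) :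
    (φ : F p N →* Γ).ker = relSubgroup α := by
  refine le_antisymm (fun x hx => ?_) (relSubgroup_le_ker hα)
  by_contra hxR
  obtain ⟨K, hK⟩ := exists_completionProj_ne (Subgroup.isClosed_topologicalClosure _) hxR
  obtain ⟨L, hL⟩ := exists_completionProj_factor hΓ φ
  obtain ⟨M, hMK, hML⟩ := exists_le_le K L
  -- a finite quotient of `F / relSubgroup α` that dominates `Γ` and in which `x` stays nontrivial
  let S : Subgroup (PQuot M) := (relSubgroup α).map (completionProj M : F p N →* PQuot M)
  have hS : S.Normal := (relSubgroup_normal α).map _ (completionProj_surjective M)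
  let f : F p N →ₜ* PQuot M ⧸ S :=
    (⟨QuotientGroup.mk' S, continuous_of_discreteTopology⟩ : PQuot M →ₜ* PQuot M ⧸ S).comp
      (completionProj M)
  have hfs : Function.Surjective f :=
    (QuotientGroup.mk'_surjective S).comp (completionProj_surjective M)
  have hf1 (y : F p N) (hy : f y = 1) :
      ∃ z ∈ relSubgroup α, completionProj M z = completionProj M y :=
    (QuotientGroup.eq_one_iff _).1 hy
  have hker : (f : F p N →* PQuot M ⧸ S).ker ≤ (φ : F p N →* Γ).ker := by
    intro y hy
    obtain ⟨z, hz, hzy⟩ := hf1 y hy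
    have h1 : φ (z⁻¹ * y) = 1 := hL _ (by
      rw [← map_one (completionProj L)]
      refine completionProj_eq_of_le hML ?_
      rw [map_mul, map_inv, hzy, inv_mul_cancel, map_one])
    have h2 : φ z = 1 := relSubgroup_le_ker hα hz
    rw [map_mul, map_inv, h2, inv_one, one_mul] at h1
    exact h1
  let π : PQuot M ⧸ S →* Γ := (f : F p N →* PQuot M ⧸ S).liftOfSurjective hfs ⟨φ, hker⟩
  have hπ (y : F p N) : π (f y) = φ y :=
    (f : F p N →* PQuot M ⧸ S).liftOfRightInverse_comp_apply _
      (Function.rightInverse_surjInv hfs) ⟨(φ : F p N →* Γ), hker⟩ y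
  have hπs : Function.Surjective π := fun y => by
    obtain ⟨z, rfl⟩ := hφ y
    exact ⟨f z, hπ z⟩
  have hQ : IsPGroup p (PQuot M ⧸ S) := (isPGroup_pQuot M).to_quotient S
  have hconj (i : Fin N) : IsConj (f (gen p i)) (padicPow (f (gen p (σ i))) (q : ℤ_[p])) := by
    have h1 := MonoidHom.map_isConj (f : F p N →* PQuot M ⧸ S) (hαB i)
    change IsConj (f _) (f _) at h1
    rw [map_padicPow] at h1
    have h2 : f (α (gen p i) * (gen p i)⁻¹) = 1 :=
      (QuotientGroup.eq_one_iff _).2 ⟨_, Subgroup.le_topologicalClosure _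
        (Subgroup.subset_normalClosure ⟨i, rfl⟩), rfl⟩
    rw [map_mul, map_inv, mul_inv_eq_one] at h2
    rwa [h2] at h1
  obtain ⟨e⟩ := hab
  have hfin : Finite (WBraid q σ r) := Finite.of_equiv _ e.toEquiv
  have hcard := card_abelianization_le hQ hr (closure_range_map_gen f hfs) hconj
  have hinj := injective_of_isBalanced hbal hQ π hπs
    (hcard.trans (Nat.card_congr e.toEquiv).ge)
  have hfx : f x = 1 := hinj (by rw [hπ, map_one]; exact hx)
  obtain ⟨z, hz, hzx⟩ := hf1 x hfx
  exact hK z hz (completionProj_eq_of_le hMK hzx)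

/-- For `α ∈ B_N(q, σ)`, there are `|Aut Γ|` surjections `F → Γ` fixed by `α` if the quotient attached
to `α` is isomorphic to `Γ`, and none otherwise. -/
theorem card_fixedEpi {q : ℤ_[p]ˣ} {g : ℕ} {σ : Equiv.Perm (Fin N)} {r : Fin g → Fin N}
    (hr : IsCycleReps σ r) {Γ : Type} [Group Γ] [Finite Γ] [TopologicalSpace Γ]
    [DiscreteTopology Γ] (hΓ : IsPGroup p Γ) (hbal : IsBalanced p Γ)
    (hab : Nonempty (Additive (Abelianization Γ) ≃+ WBraid q σ r))
    {α : F p N ≃ₜ* F p N} (hαB : α ∈ braidCoset q σ) :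
    (Nonempty (BraidGroupQuot α ≃* Γ) ↔ (fixedEpi Γ α).Nonempty) ∧
      ((fixedEpi Γ α).Nonempty → Nat.card (fixedEpi Γ α) = Nat.card (Γ ≃* Γ)) := by
  have hker {φ : F p N →ₜ* Γ} (hφ : φ ∈ fixedEpi Γ α) :=
    ker_eq_relSubgroup hr hΓ hbal hab hαB hφ.1 hφ.2
  refine ⟨⟨fun ⟨e⟩ => fixedEpi_nonempty_of_equiv e, fun ⟨φ, hφ⟩ => ?_⟩, fun ⟨φ, hφ⟩ => ?_⟩
  · exact ⟨(QuotientGroup.quotientMulEquivOfEq (hker hφ).symm).trans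
      (QuotientGroup.quotientKerEquivOfSurjective (φ : F p N →* Γ) hφ.1)⟩
  · symm
    refine Nat.card_congr (Equiv.ofBijective (fun θ : Γ ≃* Γ =>
      ⟨(⟨θ.toMonoidHom, continuous_of_discreteTopology⟩ : Γ →ₜ* Γ).comp φ,
        θ.surjective.comp hφ.1, fun i => congrArg θ (hφ.2 i)⟩) ⟨fun θ θ' h => ?_, fun ψ => ?_⟩)
    · ext y
      obtain ⟨x, rfl⟩ := hφ.1 y
      exact DFunLike.congr_fun (congrArg Subtype.val h) x
    · obtain ⟨θ, hθ⟩ := exists_equiv_comp_eq hφ.1 ψ.2.1 ((hker hφ).trans (hker ψ.2).symm)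
      exact ⟨θ, Subtype.ext (ContinuousMonoidHom.ext hθ)⟩

end FixedEpi

/-! ### The sets `Epi(F, (Γ, c))` -/

section EpiF

variable {p : ℕ} [Fact p.Prime] {N g : ℕ} {q : ℤ_[p]ˣ} {σ : Equiv.Perm (Fin N)}
  {r : Fin g → Fin N} {Γ : Type} [Group Γ] [TopologicalSpace Γ] [DiscreteTopology Γ]

lemma isConj_apply_of_mem_braidCoset {α : F p N ≃ₜ* F p N} (hα : α ∈ braidCoset q σ)
    (φ : F p N →ₜ* Γ) (i : Fin N) :
    IsConj (φ (α (gen p i))) (padicPow (φ (gen p (σ i))) (q : ℤ_[p])) := by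
  have h := MonoidHom.map_isConj (φ : F p N →* Γ) (hα i)
  change IsConj (φ _) (φ _) at h
  rwa [map_padicPow] at h

lemma exists_mem_carrier_of_isConj (hΓ : IsPGroup p Γ) {c : ConjClasses Γ} {y z : Γ}
    (hy : y ∈ c.carrier) {w : ℤ_[p]} (h : IsConj z (padicPow y w)) :
    ∃ y' ∈ c.carrier, z = padicPow y' w := by
  obtain ⟨d, hd⟩ := isConj_iff.1 h.symm
  refine ⟨d * y * d⁻¹, ?_, hd.symm.trans (map_padicPow_discrete hΓ (MulAut.conj d).toMonoidHom y w)⟩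
  rw [ConjClasses.mem_carrier_iff_mk_eq] at hy ⊢
  rw [← hy, ConjClasses.mk_eq_mk_iff_isConj]
  exact (isConj_iff.2 ⟨d, rfl⟩).symm

/-- The tuple `c` is determined by any element of `Epi(F, (Γ, c))`. -/
lemma mk_eq_of_mem_epiF (hΓ : IsPGroup p Γ) {c : Fin g → ConjClasses Γ} {φ : F p N →ₜ* Γ}
    (hφ : φ ∈ EpiF q σ r c) (j : Fin g) : ConjClasses.mk (φ (gen p (r j))) = c j := by
  obtain ⟨y, hy, h⟩ := hφ.2 j 0
  rw [pow_zero, pow_zero, inv_one, Units.val_one, padicPow_one hΓ, Equiv.Perm.one_apply] at h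
  rw [h, ← ConjClasses.mem_carrier_iff_mk_eq]
  exact hy

/-- The exponents `q ^ (-m)` in the definition of `Epi(F, (Γ, c))` make it stable under `B_N(q, σ)`. -/
lemma comp_mem_epiF_of_mem_braidCoset (hΓ : IsPGroup p Γ) {c : Fin g → ConjClasses Γ}
    {φ : F p N →ₜ* Γ} (hφ : φ ∈ EpiF q σ r c) {α : F p N ≃ₜ* F p N} (hα : α ∈ braidCoset q σ) :
    φ.comp (α : F p N →ₜ* F p N) ∈ EpiF q σ r c := by
  refine ⟨hφ.1.comp α.surjective, fun j m => ?_⟩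
  obtain ⟨y, hy, h⟩ := hφ.2 j (m + 1)
  have h1 := isConj_apply_of_mem_braidCoset hα φ ((σ ^ m) (r j))
  rw [← Equiv.Perm.mul_apply, ← pow_succ', h, padicPow_padicPow hΓ, ← Units.val_mul, pow_succ,
    mul_inv, inv_mul_cancel_right] at h1
  exact exists_mem_carrier_of_isConj hΓ hy h1

lemma comp_mem_epiF_of_mem_pureBraid (hΓ : IsPGroup p Γ) {c : Fin g → ConjClasses Γ}
    {φ : F p N →ₜ* Γ} (hφ : φ ∈ EpiF q σ r c) {π : F p N ≃ₜ* F p N} (hπ : π ∈ pureBraid p N) :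
    φ.comp (π : F p N →ₜ* F p N) ∈ EpiF q σ r c := by
  refine ⟨hφ.1.comp π.surjective, fun j m => ?_⟩
  obtain ⟨y, hy, h⟩ := hφ.2 j m
  have h1 := MonoidHom.map_isConj (φ : F p N →* Γ) (hπ ((σ ^ m) (r j)))
  change IsConj _ (φ _) at h1
  rw [h] at h1
  exact exists_mem_carrier_of_isConj hΓ hy h1

lemma mem_epiF_of_mem_fixedEpi (hΓ : IsPGroup p Γ) (hr : IsCycleReps σ r) {α : F p N ≃ₜ* F p N}
    (hα : α ∈ braidCoset q σ) {φ : F p N →ₜ* Γ} (hφ : φ ∈ fixedEpi Γ α) :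
    ∃ c : Fin g → ConjClasses Γ, (Subgroup.closure (⋃ j, (c j).carrier) = ⊤ ∧
      ∀ j, ClassPowFixed (c j) ((q : ℤ_[p]) ^ cycleLen σ (r j))) ∧ φ ∈ EpiF q σ r c := by
  have hx (i : Fin N) : IsConj (φ (gen p i)) (padicPow (φ (gen p (σ i))) (q : ℤ_[p])) := by
    have h := isConj_apply_of_mem_braidCoset hα φ i
    rwa [hφ.2] at h
  have hiter (j : Fin g) (m : ℕ) : ∃ y ∈ (ConjClasses.mk (φ (gen p (r j)))).carrier,
      φ (gen p ((σ ^ m) (r j))) = padicPow y (((q ^ m)⁻¹ : ℤ_[p]ˣ) : ℤ_[p]) :=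
    exists_mem_carrier_of_isConj hΓ ConjClasses.mem_carrier_mk
      (isConj_padicPow_iterate_inv hΓ hx m (r j))
  refine ⟨fun j => ConjClasses.mk (φ (gen p (r j))), ⟨?_, fun j => ?_⟩, hφ.1, hiter⟩
  · rw [eq_top_iff, ← closure_range_map_gen φ hφ.1, Subgroup.closure_le]
    rintro _ ⟨i, rfl⟩
    obtain ⟨j, m, rfl⟩ := hr.exists_pow_eq i
    obtain ⟨y, hy, h⟩ := hiter j m
    obtain ⟨k, hk⟩ := exists_padicPow_eq hΓ y (((q ^ m)⁻¹ : ℤ_[p]ˣ) : ℤ_[p])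
    simp only
    rw [h, hk]
    exact pow_mem (Subgroup.subset_closure (Set.mem_iUnion.2 ⟨j, hy⟩)) k
  · rw [classPowFixed_mk_iff hΓ]
    exact isConj_padicPow_cycleLen hΓ hx (r j)

end EpiF

/-! ### Haar measure and transitive actions -/

section Haar

/-- Double counting: if the points of `E` lie in exactly `k` of the sets `S i`, and the other points in none. -/
lemma sum_measureReal_eq {Ω ι : Type*} [MeasurableSpace Ω] (μ : Measure Ω) [IsFiniteMeasure μ]
    [Fintype ι] {S : ι → Set Ω} (hS : ∀ i, MeasurableSet (S i)) {E : Set Ω} (hE : MeasurableSet E)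
    (k : ℕ) (h1 : ∀ ω ∈ E, Nat.card {i // ω ∈ S i} = k) (h0 : ∀ ω ∉ E, ∀ i, ω ∉ S i) :
    ∑ i, μ.real (S i) = k * μ.real E := by
  classical
  have hsum (ω : Ω) : ∑ i, (S i).indicator (1 : Ω → ℝ) ω = k * E.indicator 1 ω := by
    by_cases hω : ω ∈ E
    · rw [Set.indicator_of_mem hω, ← h1 ω hω, Nat.card_eq_fintype_card, Fintype.card_subtype]
      simp [Set.indicator_apply]
    · rw [Set.indicator_of_notMem hω]
      simp [h0 ω hω]
  calc ∑ i, μ.real (S i) = ∑ i, ∫ ω, (S i).indicator 1 ω ∂μ := by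
        simp only [integral_indicator_one (hS _)]
    _ = ∫ ω, ∑ i, (S i).indicator 1 ω ∂μ :=
        (integral_finsetSum _ fun i _ => (integrable_const (1 : ℝ)).indicator (hS i)).symm
    _ = k * μ.real E := by
        simp only [hsum, integral_const_mul, integral_indicator_one hE]

variable {p N : ℕ} {Γ : Type} [Group Γ] [TopologicalSpace Γ] [DiscreteTopology Γ]

lemma comp_eq_iff (φ ψ : F p N →ₜ* Γ) (α : F p N ≃ₜ* F p N) :
    φ.comp (α : F p N →ₜ* F p N) = ψ ↔ ∀ i, φ (α (gen p i)) = ψ (gen p i) :=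
  ⟨fun h _ => DFunLike.congr_fun h _, fun h => sphere_hom_ext h⟩

lemma mem_fixedEpi_iff {α : F p N ≃ₜ* F p N} {φ : F p N →ₜ* Γ} :
    φ ∈ fixedEpi Γ α ↔ Function.Surjective φ ∧ φ.comp (α : F p N →ₜ* F p N) = φ := by
  rw [comp_eq_iff]
  rfl

lemma isClosed_comp_eq (φ ψ : F p N →ₜ* Γ) :
    IsClosed {α : F p N ≃ₜ* F p N | φ.comp (α : F p N →ₜ* F p N) = ψ} := by
  simp only [comp_eq_iff, Set.ofPred_forall]
  exact isClosed_iInter fun i => isClosed_eq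
    (φ.continuous_toFun.comp (aut_continuous_apply _)) continuous_const

variable [Fact p.Prime]

/-- A Haar random element of `P_N` moves a point of a finite orbit to a uniformly distributed point of
the orbit. -/
lemma pureBraidHaar_comp_eq [Finite Γ] {X : Set (F p N →ₜ* Γ)} (hX : PureBraidTransitive X)
    (hstab : ∀ φ ∈ X, ∀ π ∈ pureBraid p N, φ.comp (π : F p N →ₜ* F p N) ∈ X)
    {φ ψ : F p N →ₜ* Γ} (hφ : φ ∈ X) (hψ : ψ ∈ X) :
    (pureBraidHaar p N).real
      {π | φ.comp ((π : F p N ≃ₜ* F p N) : F p N →ₜ* F p N) = ψ} = (Nat.card X : ℝ)⁻¹ := by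
  -- `ψ` is fixed and `φ` varies, so that left invariance of the measure suffices
  let S (φ : F p N →ₜ* Γ) : Set (pureBraid p N) :=
    {π | φ.comp ((π : F p N ≃ₜ* F p N) : F p N →ₜ* F p N) = ψ}
  have hinv : (pureBraidHaar p N).IsMulLeftInvariant :=
    inferInstanceAs (Measure.haarMeasure ⊤).IsMulLeftInvariant
  have hmeas (φ : F p N →ₜ* Γ) : MeasurableSet (S φ) :=
    ((isClosed_comp_eq φ ψ).preimage continuous_subtype_val).measurableSet
  have heq (φ' : F p N →ₜ* Γ) (hφ' : φ' ∈ X) :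
      (pureBraidHaar p N).real (S φ') = (pureBraidHaar p N).real (S φ) := by
    obtain ⟨π, hπ, rfl⟩ := hX.2 φ hφ φ' hφ'
    have h : S (φ.comp (π : F p N →ₜ* F p N)) = (fun x => (⟨π, hπ⟩ : pureBraid p N) * x) ⁻¹' S φ :=
      rfl
    rw [h, measureReal_def, measure_preimage_mul, ← measureReal_def]
  have hfin : Fintype X := Fintype.ofFinite X
  -- for each `π` there is exactly one `φ' ∈ X` with `φ' ∘ π = ψ`, namely `ψ ∘ π⁻¹`
  have hsum := sum_measureReal_eq (pureBraidHaar p N) (S := fun φ : X => S φ) (fun φ => hmeas φ)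
    MeasurableSet.univ 1 (fun π _ => by
      rw [Nat.card_eq_one_iff_unique]
      refine ⟨⟨fun a b => Subtype.ext (Subtype.ext (ContinuousMonoidHom.ext fun x => ?_))⟩, ?_⟩
      · obtain ⟨y, rfl⟩ := (π : F p N ≃ₜ* F p N).surjective x
        exact DFunLike.congr_fun (a.2.trans b.2.symm) y
      · refine ⟨⟨ψ.comp ((π⁻¹ : pureBraid p N) : F p N ≃ₜ* F p N), hstab ψ hψ _ (π⁻¹).2⟩, ?_⟩
        refine ContinuousMonoidHom.ext fun x => ?_
        exact congrArg ψ ((π : F p N ≃ₜ* F p N).symm_apply_apply x))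
    (fun π h => absurd (Set.mem_univ π) h)
  rw [Finset.sum_congr rfl fun φ' _ => heq φ'.1 φ'.2, Finset.sum_const, Finset.card_univ,
    ← Nat.card_eq_fintype_card, nsmul_eq_mul, probReal_univ, Nat.cast_one, one_mul] at hsum
  exact eq_inv_of_mul_eq_one_right hsum

end Haar

/-! ### The distribution of `𝐆(q, σ)` -/

section Probability

variable {p : ℕ} [Fact p.Prime] {N g : ℕ} {q : ℤ_[p]ˣ} {σ : Equiv.Perm (Fin N)}
  {r : Fin g → Fin N} {Γ : Type} [Group Γ] [Finite Γ] [TopologicalSpace Γ] [DiscreteTopology Γ]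

lemma isoEvent_eq (hr : IsCycleReps σ r) (hΓ : IsPGroup p Γ) (hbal : IsBalanced p Γ)
    (hab : Nonempty (Additive (Abelianization Γ) ≃+ WBraid q σ r)) :
    isoEvent q σ Γ = braidCoset q σ ∩ ⋃ φ : {φ : F p N →ₜ* Γ // Function.Surjective φ},
      {α | φ.1.comp (α : F p N →ₜ* F p N) = φ.1} := by
  ext α
  refine and_congr_right fun hα => ?_
  rw [(card_fixedEpi hr hΓ hbal hab hα).1, Set.mem_iUnion]
  exact ⟨fun ⟨φ, hφ⟩ => ⟨⟨φ, hφ.1⟩, (mem_fixedEpi_iff.1 hφ).2⟩,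
    fun ⟨φ, hφ⟩ => ⟨φ.1, mem_fixedEpi_iff.2 ⟨φ.2, hφ⟩⟩⟩

lemma isClosed_braidCoset : IsClosed (braidCoset q σ) := by
  rw [braidCoset, Set.ofPred_forall]
  exact isClosed_iInter fun i => (isClosed_conj _).preimage (aut_continuous_apply _)

theorem measurableSet_isoEvent (hr : IsCycleReps σ r) (hΓ : IsPGroup p Γ) (hbal : IsBalanced p Γ)
    (hab : Nonempty (Additive (Abelianization Γ) ≃+ WBraid q σ r)) :
    MeasurableSet (isoEvent q σ Γ) := by
  rw [isoEvent_eq hr hΓ hbal hab]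
  exact (isClosed_braidCoset.inter
    (isClosed_iUnion_of_finite fun φ : {φ : F p N →ₜ* Γ // Function.Surjective φ} =>
      isClosed_comp_eq φ.1 φ.1)).measurableSet

lemma mul_mem_braidCoset {α π : F p N ≃ₜ* F p N} (hα : α ∈ braidCoset q σ)
    (hπ : π ∈ pureBraid p N) : α * π ∈ braidCoset q σ := fun i =>
  (MonoidHom.map_isConj (α : F p N →* F p N) (hπ i)).trans (hα i)

/-- The expected number of surjections from `𝐆(q, σ)` to `Γ` is the number of generating tuples of
conjugacy classes with `c_j ^ (q ^ k_j) = c_j`: each of the orbits `Epi(F, (Γ, c))` contributes `1`. -/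
theorem card_aut_mul_isoEvent (hr : IsCycleReps σ r) (hΓ : IsPGroup p Γ) (hbal : IsBalanced p Γ)
    (hab : Nonempty (Additive (Abelianization Γ) ≃+ WBraid q σ r))
    (htrans : TransitivityHypothesis q σ r Γ) {α₀ : F p N ≃ₜ* F p N}
    (hα₀ : α₀ ∈ braidCoset q σ) :
    (Nat.card (Γ ≃* Γ) : ℝ) * (cosetHaar α₀).real (isoEvent q σ Γ) =
      Nat.card {c : Fin g → ConjClasses Γ // Subgroup.closure (⋃ j, (c j).carrier) = ⊤ ∧
        ∀ j, ClassPowFixed (c j) ((q : ℤ_[p]) ^ cycleLen σ (r j))} := by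
  let C := {c : Fin g → ConjClasses Γ // Subgroup.closure (⋃ j, (c j).carrier) = ⊤ ∧
    ∀ j, ClassPowFixed (c j) ((q : ℤ_[p]) ^ cycleLen σ (r j))}
  have hCfin : Finite (ConjClasses Γ) := Quotient.finite _
  have hC : Fintype C := Fintype.ofFinite C
  have hX (c : C) : Fintype (EpiF q σ r c.1 : Set (F p N →ₜ* Γ)) := Fintype.ofFinite _
  have hmeas := measurableSet_isoEvent hr hΓ hbal hab
  have hmul : Measurable fun π : pureBraid p N => α₀ * (π : F p N ≃ₜ* F p N) :=
    (continuous_const.mul continuous_subtype_val).measurable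
  have hB (π : pureBraid p N) : α₀ * (π : F p N ≃ₜ* F p N) ∈ braidCoset q σ :=
    mul_mem_braidCoset hα₀ π.2
  let S (i : Σ c : C, (EpiF q σ r c.1 : Set (F p N →ₜ* Γ))) : Set (pureBraid p N) :=
    {π | (i.2.1.comp (α₀ : F p N →ₜ* F p N)).comp
      ((π : F p N ≃ₜ* F p N) : F p N →ₜ* F p N) = i.2.1}
  have hS (i) : MeasurableSet (S i) :=
    ((isClosed_comp_eq _ _).preimage continuous_subtype_val).measurableSet
  have hSfix (π : pureBraid p N) (i) (hi : π ∈ S i) :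
      i.2.1 ∈ fixedEpi Γ (α₀ * (π : F p N ≃ₜ* F p N)) := mem_fixedEpi_iff.2 ⟨i.2.2.1, hi⟩
  have hsum := sum_measureReal_eq (pureBraidHaar p N) hS (hmul hmeas) (Nat.card (Γ ≃* Γ))
    (fun π hπ => by
      rw [← (card_fixedEpi hr hΓ hbal hab (hB π)).2
        ((card_fixedEpi hr hΓ hbal hab (hB π)).1.1 hπ.2)]
      refine Nat.card_congr (Equiv.ofBijective (fun i => ⟨i.1.2.1, hSfix π i.1 i.2⟩) ⟨?_, ?_⟩)
      · rintro ⟨⟨⟨c, hc⟩, ⟨φ, hφ⟩⟩, hi⟩ ⟨⟨⟨c', hc'⟩, ⟨φ', hφ'⟩⟩, hi'⟩ h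
        obtain rfl : φ = φ' := congrArg Subtype.val h
        obtain rfl : c = c' := funext fun j =>
          (mk_eq_of_mem_epiF hΓ hφ j).symm.trans (mk_eq_of_mem_epiF hΓ hφ' j)
        rfl
      · rintro ⟨φ, hφ⟩
        obtain ⟨c, hc, hφc⟩ := mem_epiF_of_mem_fixedEpi hΓ hr (hB π) hφ
        exact ⟨⟨⟨⟨c, hc⟩, ⟨φ, hφc⟩⟩, (mem_fixedEpi_iff.1 hφ).2⟩, rfl⟩)
    (fun π hπ i hi => hπ ⟨hB π, (card_fixedEpi hr hΓ hbal hab (hB π)).1.2 ⟨_, hSfix π i hi⟩⟩)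
  rw [cosetHaar, map_measureReal_apply hmul hmeas, ← hsum, Fintype.sum_sigma,
    Nat.card_eq_fintype_card, ← Finset.card_univ, Finset.card_eq_sum_ones, Nat.cast_sum]
  refine Finset.sum_congr rfl fun c _ => ?_
  have htr := htrans c.1 c.2.1 c.2.2
  have hne : (Nat.card (EpiF q σ r c.1 : Set (F p N →ₜ* Γ)) : ℝ) ≠ 0 := by
    have := htr.1.to_subtype
    exact_mod_cast Nat.card_pos.ne'
  rw [Finset.sum_congr rfl fun φ _ => pureBraidHaar_comp_eq htr
    (fun φ hφ π hπ => comp_mem_epiF_of_mem_pureBraid hΓ hφ hπ)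
    (comp_mem_epiF_of_mem_braidCoset hΓ φ.2 hα₀) φ.2, Finset.sum_const, Finset.card_univ,
    ← Nat.card_eq_fintype_card, nsmul_eq_mul, mul_inv_cancel₀ hne, Nat.cast_one]

end Probability

end

end RandomProP

open RandomProP in
theorem mainTheorem1 (p : ℕ) [Fact p.Prime] (hp : p ≠ 2)
    (q : ℤ_[p]ˣ) (hq : (Subgroup.zpowers q).topologicalClosure = ⊤)
    (N g : ℕ) (hN : 1 ≤ N) (σ : Equiv.Perm (Fin N)) (r : Fin g → Fin N) (hr : IsCycleReps σ r)
    (Γ : Type) [Group Γ] [Finite Γ] [TopologicalSpace Γ] [DiscreteTopology Γ]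
    (hΓ : IsPGroup p Γ) (hbal : IsBalanced p Γ)
    (hab : Nonempty (Additive (Abelianization Γ) ≃+ WBraid q σ r))
    (htrans : TransitivityHypothesis q σ r Γ) :
    (braidCoset q σ).Nonempty ∧
      ∀ α₀ ∈ braidCoset q σ,
        MeasurableSet (isoEvent q σ Γ) ∧
        (cosetHaar α₀).real (isoEvent q σ Γ) =
          (countA (braidType q σ r) Γ : ℝ) / (Nat.card (Γ ≃* Γ) : ℝ) := by
  refine ⟨braidCoset_nonempty q σ, fun α₀ hα₀ =>
    ⟨measurableSet_isoEvent hr hΓ hbal hab, ?_⟩⟩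
  have hAut : (Nat.card (Γ ≃* Γ) : ℝ) ≠ 0 := by
    have : Finite (Γ ≃* Γ) := Finite.of_injective _ MulEquiv.toEquiv_injective
    exact_mod_cast Nat.card_pos.ne'
  rw [countA_braidType_eq hp hΓ hab, ← card_aut_mul_isoEvent hr hΓ hbal hab htrans hα₀,
    mul_div_cancel_left₀ _ hAut]
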